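/- Let $d\ge 1$ be an integer, let $p>1$ be real, and let $B_1\subset\mathbb{R}^d$ be the open unit ball centred at the origin. Let $\mathcal{S}(d)$ be the space of real symmetric $d\times d$ matrices, with the spectral norm $\|\cdot\|$. Let $\gamma_+,\gamma_-\in\mathbb{R}$ satisfy $\gamma_+\ge 0$ and $\gamma_++\gamma_->0$. Let $F:\mathcal{S}(d)\to\mathbb{R}$ be a convex function with $F(0)=0$ which is $(\lambda,\Lambda)$-uniformly elliptic for some $0<\lambda\le\Lambda$, that is, $$\lambda\|N\|\le F(M+N)-F(M)\le\Lambda\|N\|\qquad\text{for all } M,N\in\mathcal{S}(d)\text{ with } N\ge 0.$$ Let $g\in W^{2,p}(B_1)$ be convex. Denote by $W^{1,p}_g(B_1)$ the set of all $u\in W^{2,p}_{loc}(B_1)$ with $u-g\in W^{1,p}_0(B_1)$, and put $$\mathcal{A}:=\{u\in W^{2,p}(B_1)\cap W^{1,p}_g(B_1)\;:\;u\text{ is convex in }B_1\},$$ $$I[u]:=\int_{B_1}\Big([F(D^2u)]^p+\gamma_+\max(u,0)-\gamma_-\min(u,0)\Big)\,dx ,$$ where $D^2u$ is the weak Hessian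 of $u$. Then $I$ is well defined and finite on $\mathcal{A}$: for every $u\in\mathcal{A}$ one has $F(D^2u)\ge 0$ almost everywhere in $B_1$, and the integrand is integrable on $B_1$. Moreover $I$ has a minimizer in $\mathcal{A}$: there exists $u^*\in\mathcal{A}$ such that $I[u^*]\le I[u]$ for all $u\in\mathcal{A}$. -/

import Mathlib

open MeasureTheory Set Filter Topology
open scoped ContDiff ENNReal

namespace HessianEnergy

/-- Euclidean space `ℝ^d`. -/
abbrev Space (d : ℕ) := EuclideanSpace ℝ (Fin d)

/-- The open unit ball `B_1` of `ℝ^d`, centred at the origin. -/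
abbrev unitBall (d : ℕ) : Set (Space d) := Metric.ball 0 1

/-- The space `S(d)` of real symmetric `d × d` matrices. -/
def SymMat (d : ℕ) : Submodule ℝ (Matrix (Fin d) (Fin d) ℝ) where
  carrier := {M | M.IsSymm}
  add_mem' := fun ha hb => Matrix.IsSymm.add ha hb
  zero_mem' := Matrix.isSymm_zero
  smul_mem' := fun c _ h => Matrix.IsSymm.smul h c

/-- The spectral norm `‖M‖ = sup {|M x| : |x| ≤ 1}` of a symmetric matrix. -/
noncomputable def specNorm {d : ℕ} (M : SymMat d) : ℝ :=
  ‖Matrix.toEuclideanCLM (𝕜 := ℝ) (M : Matrix (Fin d) (Fin d) ℝ)‖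

/-- `(lam, Lam)`-uniform ellipticity of `F : S(d) → ℝ`, together with `F 0 = 0`. -/
structure UniformlyElliptic {d : ℕ} (lam Lam : ℝ) (F : SymMat d → ℝ) : Prop where
  pos : 0 < lam
  le : lam ≤ Lam
  lower : ∀ M N : SymMat d, (N : Matrix (Fin d) (Fin d) ℝ).PosSemidef →
    lam * specNorm N ≤ F (M + N) - F M
  upper : ∀ M N : SymMat d, (N : Matrix (Fin d) (Fin d) ℝ).PosSemidef →
    F (M + N) - F M ≤ Lam * specNorm N
  map_zero : F 0 = 0

/-- Test functions: elements of `C_c^∞(Ω)`. -/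
def IsTestFunction {d : ℕ} (Ω : Set (Space d)) (φ : Space d → ℝ) : Prop :=
  ContDiff ℝ ∞ φ ∧ HasCompactSupport φ ∧ tsupport φ ⊆ Ω

/-- The classical partial derivative `∂φ/∂x_i`. -/
noncomputable def partialDeriv {d : ℕ} (i : Fin d) (φ : Space d → ℝ) (x : Space d) : ℝ :=
  fderiv ℝ φ x (EuclideanSpace.single i 1)

/-- `v` is the weak partial derivative `∂u/∂x_i` on `Ω`. -/
def HasWeakPartial {d : ℕ} (Ω : Set (Space d)) (i : Fin d) (u v : Space d → ℝ) : Prop :=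
  LocallyIntegrableOn u Ω ∧ LocallyIntegrableOn v Ω ∧
    ∀ φ : Space d → ℝ, IsTestFunction Ω φ →
      ∫ x in Ω, u x * partialDeriv i φ x = - ∫ x in Ω, v x * φ x

/-- On an open set, weak partial derivatives are unique almost everywhere. -/
theorem HasWeakPartial.ae_eq {d : ℕ} {Ω : Set (Space d)} (hΩ : IsOpen Ω) {i : Fin d}
    {u u' v w : Space d → ℝ} (huu' : u =ᵐ[volume.restrict Ω] u')
    (hv : HasWeakPartial Ω i u v) (hw : HasWeakPartial Ω i u' w) :
    v =ᵐ[volume.restrict Ω] w := by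
  have hint : ∀ f : Space d → ℝ, LocallyIntegrableOn f Ω → ∀ φ : Space d → ℝ,
      IsTestFunction Ω φ → IntegrableOn (fun x => f x * φ x) Ω := by
    intro f hf φ hφ
    have h1 : IntegrableOn (fun x => f x * φ x) (tsupport φ) :=
      (hf.integrableOn_compact_subset hφ.2.2 hφ.2.1).mul_continuousOn
        hφ.1.continuous.continuousOn hφ.2.1
    have h2 : Integrable (fun x => f x * φ x) := by
      refine (integrableOn_iff_integrable_of_support_subset ?_).1 h1
      intro x hx
      exact subset_tsupport φ (fun h => hx (by simp [h]))
    exact h2.integrableOn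
  have key : ∀ᵐ x, x ∈ Ω → v x - w x = 0 := by
    refine hΩ.ae_eq_zero_of_integral_contDiff_smul_eq_zero (hv.2.1.sub hw.2.1) ?_
    intro φ h1 h2 h3
    have hφ : IsTestFunction Ω φ := ⟨h1, h2, h3⟩
    have e1 := hv.2.2 φ hφ
    have e2 := hw.2.2 φ hφ
    have e3 : ∫ x in Ω, u x * partialDeriv i φ x = ∫ x in Ω, u' x * partialDeriv i φ x :=
      integral_congr_ae (huu'.mono fun x hx => by simp only [hx])
    have e4 : ∫ x in Ω, (v x * φ x - w x * φ x) = 0 := by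
      rw [integral_sub (hint v hv.2.1 φ hφ) (hint w hw.2.1 φ hφ)]
      linarith
    rw [← setIntegral_eq_integral_of_forall_compl_eq_zero (s := Ω), ← e4]
    · refine integral_congr_ae (Eventually.of_forall fun x => ?_)
      simp only [smul_eq_mul]
      ring
    · intro x hx
      have : φ x = 0 := by
        by_contra h
        exact hx (h3 (subset_tsupport φ h))
      simp [this]
  have := (ae_restrict_iff' hΩ.measurableSet).2 key
  exact this.mono fun x hx => sub_eq_zero.1 hx

/-- `H` is the weak Hessian `D²u` on `Ω`. Mixed weak derivatives agree almost everywhere, so the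
Hessian is taken with values in the symmetric matrices. -/
def IsWeakHessian {d : ℕ} (Ω : Set (Space d)) (u : Space d → ℝ) (H : Space d → SymMat d) :
    Prop :=
  ∃ G : Fin d → Space d → ℝ, (∀ i, HasWeakPartial Ω i u (G i)) ∧
    ∀ i j, HasWeakPartial Ω j (G i) (fun x => (H x : Matrix (Fin d) (Fin d) ℝ) i j)

/-- On an open set, the weak Hessian is unique almost everywhere, and it depends only on the
almost everywhere class of the function. -/
theorem IsWeakHessian.ae_eq {d : ℕ} {Ω : Set (Space d)} (hΩ : IsOpen Ω)
    {u u' : Space d → ℝ} {H K : Space d → SymMat d} (huu' : u =ᵐ[volume.restrict Ω] u')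
    (hH : IsWeakHessian Ω u H) (hK : IsWeakHessian Ω u' K) :
    H =ᵐ[volume.restrict Ω] K := by
  obtain ⟨G, hG, hH⟩ := hH
  obtain ⟨G', hG', hK⟩ := hK
  have h : ∀ i j, ∀ᵐ x ∂(volume.restrict Ω),
      (H x : Matrix (Fin d) (Fin d) ℝ) i j = (K x : Matrix (Fin d) (Fin d) ℝ) i j :=
    fun i j => HasWeakPartial.ae_eq hΩ (HasWeakPartial.ae_eq hΩ huu' (hG i) (hG' i))
      (hH i j) (hK i j)
  have h' := ae_all_iff.2 fun i => ae_all_iff.2 (h i)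
  exact h'.mono fun x hx => Subtype.ext (Matrix.ext hx)

/-- The weak Hessian `D²u` on `Ω` of a function that has one (a representative of it). -/
noncomputable def weakHessian {d : ℕ} (Ω : Set (Space d)) (u : Space d → ℝ) :
    Space d → SymMat d :=
  Classical.epsilon (IsWeakHessian Ω u)

theorem isWeakHessian_weakHessian {d : ℕ} {Ω : Set (Space d)} {u : Space d → ℝ}
    {H : Space d → SymMat d} (h : IsWeakHessian Ω u H) :
    IsWeakHessian Ω u (weakHessian Ω u) :=
  Classical.epsilon_spec (p := IsWeakHessian Ω u) ⟨H, h⟩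

/-- `v ∈ L^p(Ω)`, for a real exponent `p`. -/
def MemLpOn {d : ℕ} (p : ℝ) (Ω : Set (Space d)) (v : Space d → ℝ) : Prop :=
  MemLp v (ENNReal.ofReal p) (volume.restrict Ω)

/-- The Sobolev space `W^{2,p}(Ω)`: the function and its weak derivatives of orders one and two
lie in `L^p(Ω)`. -/
def MemW2 {d : ℕ} (p : ℝ) (Ω : Set (Space d)) (u : Space d → ℝ) : Prop :=
  MemLpOn p Ω u ∧
    ∃ (G : Fin d → Space d → ℝ) (H : Space d → SymMat d),
      (∀ i, HasWeakPartial Ω i u (G i) ∧ MemLpOn p Ω (G i)) ∧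
      ∀ i j, HasWeakPartial Ω j (G i) (fun x => (H x : Matrix (Fin d) (Fin d) ℝ) i j) ∧
        MemLpOn p Ω (fun x => (H x : Matrix (Fin d) (Fin d) ℝ) i j)

/-- The local Sobolev space `W^{2,p}_loc(Ω)`. -/
def MemW2Loc {d : ℕ} (p : ℝ) (Ω : Set (Space d)) (u : Space d → ℝ) : Prop :=
  ∀ V : Set (Space d), IsOpen V → IsCompact (closure V) → closure V ⊆ Ω → MemW2 p V u

/-- The space `W^{1,p}_0(Ω)`: the closure of `C_c^∞(Ω)` in `W^{1,p}(Ω)`. -/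
def MemW1Zero {d : ℕ} (p : ℝ) (Ω : Set (Space d)) (w : Space d → ℝ) : Prop :=
  MemLpOn p Ω w ∧
    ∃ G : Fin d → Space d → ℝ, (∀ i, HasWeakPartial Ω i w (G i) ∧ MemLpOn p Ω (G i)) ∧
      ∃ φ : ℕ → Space d → ℝ, (∀ n, IsTestFunction Ω (φ n)) ∧
        Tendsto (fun n => eLpNorm (fun x => φ n x - w x) (ENNReal.ofReal p)
          (volume.restrict Ω)) atTop (𝓝 0) ∧
        ∀ i, Tendsto (fun n => eLpNorm (fun x => partialDeriv i (φ n) x - G i x)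
          (ENNReal.ofReal p) (volume.restrict Ω)) atTop (𝓝 0)

/-- The space `W^{1,p}_g(B_1)`: all `u ∈ W^{2,p}_loc(B_1)` with `u - g ∈ W^{1,p}_0(B_1)`. -/
def MemW1Boundary {d : ℕ} (p : ℝ) (g u : Space d → ℝ) : Prop :=
  MemW2Loc p (unitBall d) u ∧ MemW1Zero p (unitBall d) (fun x => u x - g x)

/-- The admissible class: convex functions in `W^{2,p}(B_1) ∩ W^{1,p}_g(B_1)`. -/
def admissible {d : ℕ} (p : ℝ) (g : Space d → ℝ) : Set (Space d → ℝ) :=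
  {u | MemW2 p (unitBall d) u ∧ MemW1Boundary p g u ∧ ConvexOn ℝ (unitBall d) u}

/-- The integrand `F(D²u)^p + γ₊ max(u,0) - γ₋ min(u,0)` of the energy. -/
noncomputable def energyDensity {d : ℕ} (F : SymMat d → ℝ) (p γp γm : ℝ) (u : Space d → ℝ)
    (x : Space d) : ℝ :=
  F (weakHessian (unitBall d) u x) ^ p + γp * max (u x) 0 - γm * min (u x) 0

/-- The energy `I[u]`, the integral of the density over `B_1`. -/
noncomputable def energy {d : ℕ} (F : SymMat d → ℝ) (p γp γm : ℝ) (u : Space d → ℝ) : ℝ :=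
  ∫ x in unitBall d, energyDensity F p γp γm u x

end HessianEnergy

open HessianEnergy

/-!
The proof is the direct method of the calculus of variations, arranged so that no weak compactness
in `L^p` is needed.

*Positivity.* The weak Hessian of a convex function is positive semidefinite almost everywhere
(`ae_posSemidef_of_convexOn`): tested against a nonnegative test function, its second weak
derivative in a direction `h` is a limit of second differences of the convex function. Uniform
ellipticity then gives `F(D²u) ≥ lam ‖D²u‖ ≥ 0`, and since `F` is Lipschitz
(`UniformlyElliptic.exists_lipschitz`) the integrand is integrable.

*Coercivity.* For `w = u - g ∈ W^{2,p} ∩ W^{1,p}_0` the first derivatives have mean zero, so the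
Poincaré inequality on `W^{1,p}_0` and the one for functions of mean zero bound the full norm of `w`
by the norm of its Hessian (`exists_sobolev_bound`). Both inequalities come from the estimate of the
increment `f(x + h) - f(x)` of a weakly differentiable function by its gradient
(`ae_sub_eq_integral_weakDeriv`). Hence the full norm of an admissible `u` is controlled by
`‖F(D²u)‖_p`, and as the zero-order part of the energy is of linear growth and `p > 1`, sublevel
sets of the energy are bounded (`exists_coercive`). This also covers `γ₋ < 0`.

*Convexity.* `F^p` is convex on positive semidefinite matrices, and `γ₊ + γ₋ ≥ 0` makes the
zero-order part convex, so sublevel sets of the energy are midpoint convex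
(`energy_midpoint_le`).

*Compactness.* A decreasing sequence of nonempty, bounded, midpoint convex sets in `L^p` has a
strongly convergent selection: elements of almost minimal norm are Cauchy because `L^p` is uniformly
convex (`exists_selection_tendsto`). Applied to the sublevel sets `I ≤ inf I + 1/(n+1)`, this
produces a minimizing sequence that converges strongly in `W^{2,p}`. The limit stays in the boundary
class, has a convex representative (`exists_convexOn_ae_eq`), and the energy is continuous along the
sequence (`tendsto_energy`).
-/

namespace HessianEnergy

/-! ### Uniform convexity of `L^p` -/

theorem abs_midpoint_rpow_lt {p : ℝ} (hp : 1 < p) {a b : ℝ} (hab : a ≠ b) :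
    |(a + b) / 2| ^ p < (|a| ^ p + |b| ^ p) / 2 := by
  have hp0 : 0 < p := by linarith
  by_cases h : |a| = |b|
  · have hb : b = -a := by
      rcases abs_eq_abs.1 h with h | h
      · exact absurd h hab
      · linarith
    have ha : a ≠ 0 := by rintro rfl; simp [hb] at hab
    subst hb
    simp only [add_neg_cancel, zero_div, abs_zero, abs_neg, add_self_div_two]
    rw [Real.zero_rpow hp0.ne']
    exact Real.rpow_pos_of_pos (abs_pos.2 ha) p
  · have h1 := (strictConvexOn_rpow hp).2 (show |a| ∈ Ici (0 : ℝ) from abs_nonneg a)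
      (show |b| ∈ Ici (0 : ℝ) from abs_nonneg b) h (show (0 : ℝ) < 1 / 2 by norm_num)
      (show (0 : ℝ) < 1 / 2 by norm_num) (by norm_num)
    simp only [smul_eq_mul] at h1
    have h2 : |(a + b) / 2| ≤ 1 / 2 * |a| + 1 / 2 * |b| := by
      rw [abs_div, abs_two]
      linarith [abs_add_le a b]
    linarith [Real.rpow_le_rpow (abs_nonneg _) h2 hp0.le]

theorem abs_midpoint_rpow_le {p : ℝ} (hp : 1 < p) (a b : ℝ) :
    |(a + b) / 2| ^ p ≤ (|a| ^ p + |b| ^ p) / 2 := by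
  by_cases hab : a = b
  · subst hab; simp
  · exact (abs_midpoint_rpow_lt hp hab).le

theorem continuous_abs_rpow {p : ℝ} (hp : 1 < p) : Continuous fun a : ℝ => |a| ^ p :=
  continuous_abs.rpow_const fun _ => Or.inr (by linarith)

/-- Quantitative strict convexity of `|x|^p`. By homogeneity it is enough to consider
`|a|^p + |b|^p = 1`, where it follows from strict convexity and compactness. -/
theorem exists_abs_sub_rpow_le {p : ℝ} (hp : 1 < p) {ε : ℝ} (hε : 0 < ε) :
    ∃ C : ℝ, 0 ≤ C ∧ ∀ a b : ℝ, |a - b| ^ p ≤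
      ε * (|a| ^ p + |b| ^ p) + C * ((|a| ^ p + |b| ^ p) / 2 - |(a + b) / 2| ^ p) := by
  have hp0 : 0 < p := by linarith
  have hc := continuous_abs_rpow hp
  let K : Set (ℝ × ℝ) := {z | |z.1| ^ p + |z.2| ^ p = 1 ∧ ε ≤ |z.1 - z.2| ^ p}
  have hKclosed : IsClosed K :=
    (isClosed_eq ((hc.comp continuous_fst).add (hc.comp continuous_snd)) continuous_const).inter
      (isClosed_le continuous_const (hc.comp (continuous_fst.sub continuous_snd)))
  have hle1 : ∀ x : ℝ, |x| ^ p ≤ 1 → |x| ≤ 1 := fun x hx => by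
    by_contra h
    exact absurd (Real.one_lt_rpow (not_le.1 h) hp0) (not_lt.2 hx)
  have hnn : ∀ x : ℝ, 0 ≤ |x| ^ p := fun x => Real.rpow_nonneg (abs_nonneg x) p
  have hKsub : K ⊆ Icc (-1) 1 ×ˢ Icc (-1) 1 := by
    rintro ⟨a, b⟩ ⟨h, -⟩
    simp only at h
    exact ⟨abs_le.1 (hle1 a (by linarith [hnn b])), abs_le.1 (hle1 b (by linarith [hnn a]))⟩
  have hKcompact : IsCompact K :=
    (isCompact_Icc.prod isCompact_Icc).of_isClosed_subset hKclosed hKsub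
  let gap : ℝ × ℝ → ℝ := fun z => (|z.1| ^ p + |z.2| ^ p) / 2 - |(z.1 + z.2) / 2| ^ p
  have hgapc : Continuous gap :=
    (((hc.comp continuous_fst).add (hc.comp continuous_snd)).div_const 2).sub
      (hc.comp ((continuous_fst.add continuous_snd).div_const 2))
  obtain ⟨δ, hδ, hgap⟩ : ∃ δ > 0, ∀ z ∈ K, δ ≤ gap z := by
    rcases K.eq_empty_or_nonempty with hK | hK
    · exact ⟨1, one_pos, fun z hz => by simp [hK] at hz⟩
    · obtain ⟨z, hz, hmin⟩ := hKcompact.exists_isMinOn hK hgapc.continuousOn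
      refine ⟨gap z, ?_, fun y hy => hmin hy⟩
      have hne : z.1 ≠ z.2 := by
        intro h
        have := hz.2
        rw [h, sub_self, abs_zero, Real.zero_rpow hp0.ne'] at this
        linarith
      have := abs_midpoint_rpow_lt hp hne
      simp only [gap]
      linarith
  -- `|a - b|^p ≤ 2^p (|a|^p + |b|^p)` always, and off the range of the `ε` term the gap is at least
  -- `δ (|a|^p + |b|^p)`
  refine ⟨2 ^ p / δ, by positivity, fun a b => ?_⟩
  have hgap0 : 0 ≤ (|a| ^ p + |b| ^ p) / 2 - |(a + b) / 2| ^ p := by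
    linarith [abs_midpoint_rpow_le hp a b]
  set s := |a| ^ p + |b| ^ p with hs
  have hs0 : 0 ≤ s := add_nonneg (hnn a) (hnn b)
  by_cases hcase : |a - b| ^ p ≤ ε * s
  · have : 0 ≤ 2 ^ p / δ * (s / 2 - |(a + b) / 2| ^ p) := by positivity
    linarith
  push Not at hcase
  have hspos : 0 < s := by
    rcases hs0.lt_or_eq with h | h
    · exact h
    · exfalso
      have ha : |a| ^ p = 0 := by linarith [hnn a, hnn b]
      have hb : |b| ^ p = 0 := by linarith [hnn a, hnn b]
      rw [Real.rpow_eq_zero (abs_nonneg _) hp0.ne', abs_eq_zero] at ha hb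
      rw [ha, hb, sub_self, abs_zero, Real.zero_rpow hp0.ne', ← h] at hcase
      linarith
  set r := s ^ (1 / p) with hr
  have hrpos : 0 < r := Real.rpow_pos_of_pos hspos _
  have hrp : r ^ p = s := by
    rw [hr, ← Real.rpow_mul hs0, one_div_mul_cancel hp0.ne', Real.rpow_one]
  have hscale : ∀ x : ℝ, |x / r| ^ p = |x| ^ p / s := fun x => by
    rw [abs_div, abs_of_pos hrpos, Real.div_rpow (abs_nonneg _) hrpos.le, hrp]
  have hmem : (a / r, b / r) ∈ K := by
    refine ⟨?_, ?_⟩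
    · simp only [hscale]
      rw [← add_div, ← hs, div_self hspos.ne']
    · simp only
      rw [← sub_div, hscale, le_div_iff₀ hspos]
      exact hcase.le
  have h1 := hgap _ hmem
  simp only [gap] at h1
  rw [hscale, hscale, ← add_div a b, div_right_comm (a + b), hscale, ← add_div, ← hs,
    div_self hspos.ne'] at h1
  have h2 : δ * s ≤ s / 2 - |(a + b) / 2| ^ p := by
    have : (1 / 2 - |(a + b) / 2| ^ p / s) * s = s / 2 - |(a + b) / 2| ^ p := by
      field_simp
    rw [← this]
    exact mul_le_mul_of_nonneg_right h1 hs0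
  have habs : ∀ x : ℝ, |x| ^ p ≤ s → |x| ≤ r := fun x hx => by
    rw [← hrp] at hx
    exact (Real.rpow_le_rpow_iff (abs_nonneg _) hrpos.le hp0).1 hx
  have h3 : |a - b| ^ p ≤ 2 ^ p * s := by
    rw [← hrp, ← Real.mul_rpow (by norm_num) hrpos.le]
    refine Real.rpow_le_rpow (abs_nonneg _) ?_ hp0.le
    linarith [abs_sub a b, habs a (by linarith [hnn b]), habs b (by linarith [hnn a])]
  have h4 : 2 ^ p * s ≤ 2 ^ p / δ * (s / 2 - |(a + b) / 2| ^ p) := by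
    calc (2 : ℝ) ^ p * s = 2 ^ p / δ * (δ * s) := by field_simp
      _ ≤ _ := by gcongr
  nlinarith [mul_nonneg hε.le hs0]

section UniformConvexity

variable {α κ : Type*} [MeasurableSpace α] {μ : Measure α} [Fintype κ]

theorem integrable_abs_rpow {p : ℝ} (hp : 1 < p) {f : α → ℝ}
    (hf : MemLp f (ENNReal.ofReal p) μ) : Integrable (fun x => |f x| ^ p) μ := by
  have h := hf.integrable_norm_rpow (by simp; linarith) (by simp)
  rw [ENNReal.toReal_ofReal (by linarith)] at h
  exact h

theorem eLpNorm_eq_ofReal_integral {p : ℝ} (hp : 1 < p) {f : α → ℝ}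
    (hf : MemLp f (ENNReal.ofReal p) μ) :
    eLpNorm f (ENNReal.ofReal p) μ = ENNReal.ofReal ((∫ x, |f x| ^ p ∂μ) ^ (1 / p)) := by
  have h := hf.eLpNorm_eq_integral_rpow_norm (by simp; linarith) (by simp)
  rw [ENNReal.toReal_ofReal (by linarith)] at h
  simpa using h

/-- The `p`-th power of the `L^p` norm of a finite family of functions. -/
noncomputable def powerSum (p : ℝ) (μ : Measure α) (f : κ → α → ℝ) : ℝ :=
  ∑ k, ∫ x, |f k x| ^ p ∂μ

theorem powerSum_nonneg (p : ℝ) (f : κ → α → ℝ) : 0 ≤ powerSum p μ f :=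
  Finset.sum_nonneg fun _ _ => integral_nonneg fun _ => Real.rpow_nonneg (abs_nonneg _) p

theorem memLp_midpoint {q : ℝ≥0∞} {f g : α → ℝ} (hf : MemLp f q μ) (hg : MemLp g q μ) :
    MemLp (fun x => (f x + g x) / 2) q μ := by
  refine ((hf.add hg).const_mul (1 / 2)).ae_eq (Eventually.of_forall fun x => ?_)
  simp only [Pi.add_apply]
  ring

theorem powerSum_sub_le {p : ℝ} (hp : 1 < p) {ε C : ℝ}
    (hC : ∀ a b : ℝ, |a - b| ^ p ≤
      ε * (|a| ^ p + |b| ^ p) + C * ((|a| ^ p + |b| ^ p) / 2 - |(a + b) / 2| ^ p))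
    {f g : κ → α → ℝ} (hf : ∀ k, MemLp (f k) (ENNReal.ofReal p) μ)
    (hg : ∀ k, MemLp (g k) (ENNReal.ofReal p) μ) :
    powerSum p μ (fun k x => f k x - g k x) ≤ ε * (powerSum p μ f + powerSum p μ g) +
      C * ((powerSum p μ f + powerSum p μ g) / 2 -
        powerSum p μ (fun k x => (f k x + g k x) / 2)) := by
  have key : ∀ k, ∫ x, |f k x - g k x| ^ p ∂μ ≤
      ε * ((∫ x, |f k x| ^ p ∂μ) + ∫ x, |g k x| ^ p ∂μ) +
      C * (((∫ x, |f k x| ^ p ∂μ) + ∫ x, |g k x| ^ p ∂μ) / 2 -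
        ∫ x, |(f k x + g k x) / 2| ^ p ∂μ) := by
    intro k
    have if' := integrable_abs_rpow hp (hf k)
    have ig' := integrable_abs_rpow hp (hg k)
    have im := integrable_abs_rpow hp (memLp_midpoint (hf k) (hg k))
    have is := integrable_abs_rpow hp ((hf k).sub (hg k))
    have h1 : Integrable (fun x => |f k x| ^ p + |g k x| ^ p) μ := if'.add ig'
    have h2 : Integrable (fun x => ε * (|f k x| ^ p + |g k x| ^ p)) μ := h1.const_mul ε
    have h3 : Integrable (fun x => (|f k x| ^ p + |g k x| ^ p) / 2) μ := h1.div_const 2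
    have h4 : Integrable (fun x => C * ((|f k x| ^ p + |g k x| ^ p) / 2 -
      |(f k x + g k x) / 2| ^ p)) μ := (h3.sub im).const_mul C
    rw [← integral_add if' ig', ← integral_const_mul, ← integral_div,
      ← integral_sub h3 im, ← integral_const_mul, ← integral_add h2 h4]
    exact integral_mono is (h2.add h4) fun x => hC _ _
  unfold powerSum
  refine (Finset.sum_le_sum fun k _ => key k).trans (le_of_eq ?_)
  rw [Finset.sum_add_distrib, ← Finset.mul_sum, ← Finset.mul_sum, Finset.sum_sub_distrib,
    ← Finset.sum_div, Finset.sum_add_distrib]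

theorem exists_tendsto_eLpNorm_of_cauchy {q : ℝ≥0∞} (hq : 1 ≤ q) {f : ℕ → α → ℝ}
    (hf : ∀ n, MemLp (f n) q μ)
    (hc : ∀ ε > 0, ∃ N, ∀ n ≥ N, ∀ m ≥ N, eLpNorm (f n - f m) q μ ≤ ENNReal.ofReal ε) :
    ∃ g, MemLp g q μ ∧ Tendsto (fun n => eLpNorm (f n - g) q μ) atTop (𝓝 0) := by
  have : Fact (1 ≤ q) := ⟨hq⟩
  have hC : CauchySeq fun n => (hf n).toLp (f n) := by
    rw [Metric.cauchySeq_iff']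
    intro ε hε
    obtain ⟨N, hN⟩ := hc (ε / 2) (by positivity)
    refine ⟨N, fun n hn => ?_⟩
    rw [dist_eq_norm, ← MemLp.toLp_sub, Lp.norm_toLp]
    have := ENNReal.toReal_mono ENNReal.ofReal_ne_top (hN n hn N le_rfl)
    rw [ENNReal.toReal_ofReal (by positivity)] at this
    linarith
  obtain ⟨g, hg⟩ := cauchySeq_tendsto_of_complete hC
  refine ⟨g, Lp.memLp g, ?_⟩
  rw [Lp.tendsto_Lp_iff_tendsto_eLpNorm'] at hg
  refine hg.congr fun n => eLpNorm_congr_ae ?_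
  exact (hf n).coeFn_toLp.sub EventuallyEq.rfl

/-- A decreasing sequence of nonempty, midpoint-convex and bounded sets of families of `L^p`
functions, `1 < p`, admits a selection that converges strongly. Elements that almost minimise the
norm over each set form a Cauchy sequence, by uniform convexity; this takes the place of a weak
compactness argument. -/
theorem exists_selection_tendsto {p : ℝ} (hp : 1 < p) {S : ℕ → Set (κ → α → ℝ)}
    (hanti : Antitone S) (hne : ∀ n, (S n).Nonempty)
    (hmid : ∀ n, ∀ f ∈ S n, ∀ g ∈ S n, (fun k x => (f k x + g k x) / 2) ∈ S n)
    (hLp : ∀ f ∈ S 0, ∀ k, MemLp (f k) (ENNReal.ofReal p) μ)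
    {R : ℝ} (hR : ∀ f ∈ S 0, powerSum p μ f ≤ R) :
    ∃ (f : ℕ → κ → α → ℝ) (g : κ → α → ℝ), (∀ n, f n ∈ S n) ∧
      (∀ k, MemLp (g k) (ENNReal.ofReal p) μ) ∧
      ∀ k, Tendsto (fun n => eLpNorm (fun x => f n k x - g k x) (ENNReal.ofReal p) μ)
        atTop (𝓝 0) := by
  have hp0 : 0 < p := by linarith
  have hsub0 : ∀ n, S n ⊆ S 0 := fun n => hanti (Nat.zero_le n)
  let s : ℕ → ℝ := fun n => sInf (powerSum p μ '' S n)
  have hbdd : ∀ n, BddBelow (powerSum p μ '' S n) := fun n =>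
    ⟨0, by rintro _ ⟨f, -, rfl⟩; exact powerSum_nonneg p f⟩
  have hsle : ∀ n, ∀ f ∈ S n, s n ≤ powerSum p μ f := fun n f hf =>
    csInf_le (hbdd n) (mem_image_of_mem _ hf)
  have hsmono : Monotone s := fun n m hnm =>
    csInf_le_csInf (hbdd n) ((hne m).image _) (image_mono (hanti hnm))
  have hsR : BddAbove (range s) := ⟨R, by
    rintro _ ⟨n, rfl⟩
    obtain ⟨f, hf⟩ := hne n
    exact (hsle n f hf).trans (hR f (hsub0 n hf))⟩
  have hslim := tendsto_atTop_ciSup hsmono hsR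
  set s' := ⨆ n, s n
  have hex : ∀ n : ℕ, ∃ f ∈ S n, powerSum p μ f < s n + 1 / ((n : ℝ) + 1) := fun n => by
    obtain ⟨_, ⟨f, hf, rfl⟩, hlt⟩ := exists_lt_of_csInf_lt ((hne n).image (powerSum p μ))
      (show sInf (powerSum p μ '' S n) < s n + 1 / ((n : ℝ) + 1) by
        have : (0 : ℝ) < 1 / ((n : ℝ) + 1) := by positivity
        simp only [s]; linarith)
    exact ⟨f, hf, hlt⟩
  choose f hfS hflt using hex
  have hfLp : ∀ n k, MemLp (f n k) (ENNReal.ofReal p) μ := fun n => hLp _ (hsub0 n (hfS n))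
  -- this quantity bounds the midpoint gap of any two selected elements of index at least `N`
  have hη : Tendsto (fun N : ℕ => s' - s N + 1 / ((N : ℝ) + 1)) atTop (𝓝 0) := by
    simpa using (hslim.const_sub s').add tendsto_one_div_add_atTop_nhds_zero_nat
  have hcauchy : ∀ ε > 0, ∃ N, ∀ n ≥ N, ∀ m ≥ N,
      powerSum p μ (fun k x => f n k x - f m k x) ≤ ε := by
    intro ε hε
    have hR0 : 0 ≤ R := by
      obtain ⟨f, hf⟩ := hne 0
      exact (powerSum_nonneg p f).trans (hR f hf)
    obtain ⟨C, hC0, hC⟩ := exists_abs_sub_rpow_le hp (ε := ε / (4 * (R + 1))) (by positivity)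
    obtain ⟨N, hN⟩ := (hη.eventually (gt_mem_nhds
      (show (0 : ℝ) < ε / (2 * (C + 1)) by positivity))).exists
    refine ⟨N, fun n hn m hm => ?_⟩
    have h1 := powerSum_sub_le hp hC (hfLp n) (hfLp m)
    have hup : ∀ n ≥ N, powerSum p μ (f n) ≤ s' + 1 / ((N : ℝ) + 1) := fun n hn => by
      have h2 := hflt n
      have h3 : s n ≤ s' := le_ciSup hsR n
      have h4 : 1 / ((n : ℝ) + 1) ≤ 1 / ((N : ℝ) + 1) := by gcongr
      linarith
    have hlow := hsle N _ (hmid N _ (hanti hn (hfS n)) _ (hanti hm (hfS m)))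
    have hb : ∀ n, powerSum p μ (f n) ≤ R := fun n => hR _ (hsub0 n (hfS n))
    have h5 : ε / (4 * (R + 1)) * (powerSum p μ (f n) + powerSum p μ (f m)) ≤ ε / 2 := by
      calc _ ≤ ε / (4 * (R + 1)) * (2 * (R + 1)) := by
            gcongr; linarith [hb n, hb m]
        _ = ε / 2 := by field_simp; norm_num
    have h6 : C * ((powerSum p μ (f n) + powerSum p μ (f m)) / 2 -
        powerSum p μ (fun k x => (f n k x + f m k x) / 2)) ≤ ε / 2 := by
      calc _ ≤ C * (ε / (2 * (C + 1))) := by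
            gcongr; linarith [hup n hn, hup m hm]
        _ ≤ (C + 1) * (ε / (2 * (C + 1))) := by gcongr; linarith
        _ = ε / 2 := by field_simp
    linarith
  have hlim : ∀ k, ∃ g, MemLp g (ENNReal.ofReal p) μ ∧
      Tendsto (fun n => eLpNorm (f n k - g) (ENNReal.ofReal p) μ) atTop (𝓝 0) := by
    intro k
    refine exists_tendsto_eLpNorm_of_cauchy (ENNReal.one_le_ofReal.2 hp.le) (fun n => hfLp n k) ?_
    intro ε hε
    obtain ⟨N, hN⟩ := hcauchy (ε ^ p) (by positivity)
    refine ⟨N, fun n hn m hm => ?_⟩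
    rw [eLpNorm_eq_ofReal_integral hp ((hfLp n k).sub (hfLp m k))]
    refine ENNReal.ofReal_le_ofReal ?_
    have h1 : ∫ x, |(f n k - f m k) x| ^ p ∂μ ≤ ε ^ p := by
      refine le_trans ?_ (hN n hn m hm)
      exact Finset.single_le_sum (f := fun k => ∫ x, |f n k x - f m k x| ^ p ∂μ)
        (fun k _ => integral_nonneg fun _ => Real.rpow_nonneg (abs_nonneg _) p) (Finset.mem_univ k)
    calc _ ≤ (ε ^ p) ^ (1 / p) := Real.rpow_le_rpow
          (integral_nonneg fun _ => Real.rpow_nonneg (abs_nonneg _) p) h1 (by positivity)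
      _ = ε := by rw [← Real.rpow_mul hε.le, mul_one_div_cancel hp0.ne', Real.rpow_one]
  choose g hg hglim using hlim
  exact ⟨f, g, hfS, hg, hglim⟩

end UniformConvexity

/-! ### Test functions and directional weak derivatives -/

section TestFunctions

variable {d : ℕ} {Ω : Set (Space d)} {φ : Space d → ℝ}

theorem IsTestFunction.directionalDeriv (hφ : IsTestFunction Ω φ) (h : Space d) :
    IsTestFunction Ω fun x => fderiv ℝ φ x h := by
  refine ⟨?_, hφ.2.1.fderiv_apply ℝ h, ?_⟩
  · exact (hφ.1.fderiv_right (m := ∞) (by simp)).clm_apply contDiff_const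
  · refine Subset.trans ?_ ((tsupport_fderiv_subset ℝ).trans hφ.2.2)
    refine closure_mono fun x hx => ?_
    simp only [Function.mem_support] at hx ⊢
    intro h0
    simp [h0] at hx

theorem IsTestFunction.mono {Ω' : Set (Space d)} (hφ : IsTestFunction Ω φ) (h : Ω ⊆ Ω') :
    IsTestFunction Ω' φ :=
  ⟨hφ.1, hφ.2.1, hφ.2.2.trans h⟩

theorem IsTestFunction.eq_zero (hφ : IsTestFunction Ω φ) {x : Space d} (hx : x ∉ Ω) : φ x = 0 :=
  image_eq_zero_of_notMem_tsupport fun h => hx (hφ.2.2 h)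

theorem IsTestFunction.exists_bound (hφ : IsTestFunction Ω φ) : ∃ C, ∀ x, ‖φ x‖ ≤ C :=
  hφ.2.1.exists_bound_of_continuous hφ.1.continuous

theorem IsTestFunction.integrableOn_mul {f : Space d → ℝ} (hf : LocallyIntegrableOn f Ω)
    (hφ : IsTestFunction Ω φ) : IntegrableOn (fun x => f x * φ x) Ω := by
  have h1 : IntegrableOn (fun x => f x * φ x) (tsupport φ) :=
    (hf.integrableOn_compact_subset hφ.2.2 hφ.2.1).mul_continuousOn
      hφ.1.continuous.continuousOn hφ.2.1
  have h2 : Integrable (fun x => f x * φ x) := by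
    refine (integrableOn_iff_integrable_of_support_subset ?_).1 h1
    intro x hx
    exact subset_tsupport φ (fun h => hx (by simp [h]))
  exact h2.integrableOn

/-- The translate `φ(· - v)` of a test function. -/
theorem IsTestFunction.comp_sub {U : Set (Space d)} (hφ : IsTestFunction U φ) {v : Space d}
    (hU : ∀ x ∈ U, x + v ∈ Ω) : IsTestFunction Ω fun x => φ (x - v) := by
  have hs : tsupport (fun x => φ (x - v)) = (fun x => x - v) ⁻¹' tsupport φ :=
    tsupport_comp_eq_preimage φ (Homeomorph.subRight v)
  refine ⟨hφ.1.comp (contDiff_id.sub contDiff_const), ?_, ?_⟩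
  · exact hφ.2.1.comp_homeomorph (Homeomorph.subRight v)
  · rw [hs]
    intro x hx
    have := hU _ (hφ.2.2 hx)
    simpa using this

theorem IsTestFunction.sub {ψ : Space d → ℝ} (hφ : IsTestFunction Ω φ) (hψ : IsTestFunction Ω ψ) :
    IsTestFunction Ω fun x => φ x - ψ x :=
  ⟨hφ.1.sub hψ.1, hφ.2.1.sub hψ.2.1, (tsupport_sub φ ψ).trans (union_subset hφ.2.2 hψ.2.2)⟩

theorem IsTestFunction.const_mul (c : ℝ) (hφ : IsTestFunction Ω φ) :
    IsTestFunction Ω fun x => c * φ x :=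
  ⟨contDiff_const.mul hφ.1, hφ.2.1.mul_left,
    (closure_mono fun x hx => by
      simp only [Function.mem_support] at hx ⊢
      exact right_ne_zero_of_mul hx).trans hφ.2.2⟩

theorem fderiv_comp_sub_const (v x : Space d) :
    fderiv ℝ (fun y => φ (y - v)) x = fderiv ℝ φ (x - v) :=
  fderiv_comp_sub v

theorem fderiv_eq_sum_partialDeriv (φ : Space d → ℝ) (x h : Space d) :
    fderiv ℝ φ x h = ∑ i, h i * partialDeriv i φ x := by
  have hh : h = ∑ i, h i • (EuclideanSpace.single i (1 : ℝ) : Space d) := by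
    have := (EuclideanSpace.basisFun (Fin d) ℝ).sum_repr h
    simpa using this.symm
  conv_lhs => rw [hh, map_sum]
  simp [partialDeriv]

/-- Weak partial derivatives combine linearly to weak directional derivatives. -/
theorem setIntegral_mul_fderiv {u : Space d → ℝ} {G : Fin d → Space d → ℝ}
    (hG : ∀ i, HasWeakPartial Ω i u (G i)) (hφ : IsTestFunction Ω φ) (h : Space d)
    (hu : LocallyIntegrableOn u Ω) :
    ∫ x in Ω, u x * fderiv ℝ φ x h = -∫ x in Ω, (∑ i, h i * G i x) * φ x := by
  have h1 : ∀ x, u x * fderiv ℝ φ x h = ∑ i, h i * (u x * partialDeriv i φ x) := fun x => by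
    rw [fderiv_eq_sum_partialDeriv, Finset.mul_sum]
    exact Finset.sum_congr rfl fun i _ => by ring
  have h2 : ∀ x, (∑ i, h i * G i x) * φ x = ∑ i, h i * (G i x * φ x) := fun x => by
    rw [Finset.sum_mul]
    exact Finset.sum_congr rfl fun i _ => by ring
  simp only [h1, h2]
  rw [integral_finsetSum, integral_finsetSum, ← Finset.sum_neg_distrib]
  · refine Finset.sum_congr rfl fun i _ => ?_
    rw [integral_const_mul, integral_const_mul, (hG i).2.2 φ hφ, mul_neg]
  · exact fun i _ => (hφ.integrableOn_mul (hG i).2.1).const_mul _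
  · exact fun i _ => ((hφ.directionalDeriv _).integrableOn_mul hu).const_mul _

theorem setIntegral_mul_eq_integral_indicator (hΩ : MeasurableSet Ω) (f g : Space d → ℝ) :
    ∫ x in Ω, f x * g x = ∫ x, Ω.indicator f x * g x := by
  rw [← integral_indicator hΩ]
  refine integral_congr_ae (Eventually.of_forall fun x => ?_)
  by_cases hx : x ∈ Ω <;> simp [hx]

end TestFunctions

/-! ### Translation of weakly differentiable functions -/

section Translation

variable {d : ℕ}

theorem measurePreserving_shear (h : Space d) :
    MeasurePreserving (fun z : ℝ × Space d => (z.1, z.2 + z.1 • h))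
      ((volume.restrict (Ioc (0 : ℝ) 1)).prod volume)
      ((volume.restrict (Ioc (0 : ℝ) 1)).prod volume) := by
  refine (MeasurePreserving.id _).skew_product (g := fun t x => x + t • h) ?_ ?_
  · exact (measurable_snd.add (measurable_fst.smul_const h))
  · exact Eventually.of_forall fun t => (measurePreserving_add_right volume (t • h)).map_eq

theorem integrable_shear {G : Space d → ℝ} (hG : Integrable G) (h : Space d) :
    Integrable (fun z : ℝ × Space d => G (z.2 + z.1 • h))
      ((volume.restrict (Ioc (0 : ℝ) 1)).prod volume) :=
  (measurePreserving_shear h).integrable_comp_of_integrable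
    (hG.comp_snd (volume.restrict (Ioc (0 : ℝ) 1)))

theorem sub_eq_integral_fderiv {φ : Space d → ℝ} (hφ : ContDiff ℝ ∞ φ) (x h : Space d) :
    φ (x + h) - φ x = ∫ t in Ioc (0 : ℝ) 1, fderiv ℝ φ (x + t • h) h := by
  have hd : ∀ t : ℝ, HasDerivAt (fun t : ℝ => φ (x + t • h)) (fderiv ℝ φ (x + t • h) h) t := by
    intro t
    have h1 : HasDerivAt (fun t : ℝ => x + t • h) h t := by
      simpa using ((hasDerivAt_id t).smul_const h).const_add x
    exact ((hφ.differentiable (by simp)).differentiableAt.hasFDerivAt).comp_hasDerivAt t h1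
  have hc : Continuous fun t : ℝ => fderiv ℝ φ (x + t • h) h :=
    ((hφ.continuous_fderiv (by simp)).comp (by fun_prop)).clm_apply continuous_const
  have := intervalIntegral.integral_eq_sub_of_hasDerivAt (a := 0) (b := 1) (fun t _ => hd t)
    (hc.intervalIntegrable _ _)
  rw [← intervalIntegral.integral_of_le zero_le_one, this]
  simp

/-- The increment of a weakly differentiable function along `h` is almost everywhere the integral
of its weak directional derivative over the segment. Both sides are tested against `φ`; on the test
function the claim is the fundamental theorem of calculus, and convexity of `Ω` keeps all translates
`φ(· - t h)` inside `Ω`. -/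
theorem ae_sub_eq_integral_weakDeriv {Ω : Set (Space d)} (hΩ : IsOpen Ω) (hconv : Convex ℝ Ω)
    {f G : Space d → ℝ} (hf : IntegrableOn f Ω) (hG : IntegrableOn G Ω) {h : Space d}
    (hfG : ∀ φ, IsTestFunction Ω φ →
      ∫ x in Ω, f x * fderiv ℝ φ x h = -∫ x in Ω, G x * φ x) :
    ∀ᵐ x, x ∈ Ω → x + h ∈ Ω →
      f (x + h) - f x = ∫ t in Ioc (0 : ℝ) 1, Ω.indicator G (x + t • h) := by
  set f' := Ω.indicator f with hf'
  set G' := Ω.indicator G with hG'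
  have hf'i : Integrable f' := hf.integrable_indicator hΩ.measurableSet
  have hG'i : Integrable G' := hG.integrable_indicator hΩ.measurableSet
  have hsh := integrable_shear hG'i h
  set P : Space d → ℝ := fun x => ∫ t in Ioc (0 : ℝ) 1, G' (x + t • h) with hP
  have hPi : Integrable P := hsh.integral_prod_right
  have hfti : Integrable fun x => f' (x + h) := hf'i.comp_add_right h
  let U : Set (Space d) := Ω ∩ (fun x => x + h) ⁻¹' Ω
  have hU : IsOpen U := hΩ.inter (hΩ.preimage (by fun_prop))
  have key : ∀ᵐ x, x ∈ U → f' (x + h) - f' x - P x = 0 := by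
    refine hU.ae_eq_zero_of_integral_contDiff_smul_eq_zero
      (((hfti.sub hf'i).sub hPi).locallyIntegrable.locallyIntegrableOn U) ?_
    intro φ hφ1 hφ2 hφ3
    have hφ : IsTestFunction U φ := ⟨hφ1, hφ2, hφ3⟩
    obtain ⟨C, hC⟩ := hφ.exists_bound
    have hmul : ∀ g : Space d → ℝ, Integrable g → Integrable fun x => φ x * g x := fun g hg =>
      hg.bdd_mul hφ1.continuous.aestronglyMeasurable (Eventually.of_forall hC)
    have hψ := hφ.directionalDeriv h
    obtain ⟨C', hC'⟩ := hψ.exists_bound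
    have htrans : ∀ t ∈ Ioc (0 : ℝ) 1, IsTestFunction Ω fun x => φ (x - t • h) := by
      intro t ht
      refine hφ.comp_sub fun x hx => ?_
      have := hconv hx.1 hx.2 (a := 1 - t) (b := t) (by linarith [ht.2]) ht.1.le (by ring)
      convert this using 1
      module
    have e1 : ∫ x, φ x * f' (x + h) = ∫ x, φ (x - h) * f' x := by
      rw [← integral_add_right_eq_self (fun x => φ (x - h) * f' x) h]
      simp
    have e2 : ∀ x, f' x * (φ (x - h) - φ x) =
        ∫ t in Ioc (0 : ℝ) 1, -(f' x * fderiv ℝ φ (x - t • h) h) := by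
      intro x
      have h1 := sub_eq_integral_fderiv hφ1 x (-h)
      simp only [smul_neg, ← sub_eq_add_neg, map_neg] at h1
      rw [h1, ← integral_const_mul]
      simp
    have e3 : ∀ t ∈ Ioc (0 : ℝ) 1, ∫ x, -(f' x * fderiv ℝ φ (x - t • h) h) =
        ∫ x, φ x * G' (x + t • h) := by
      intro t ht
      have h1 := hfG _ (htrans t ht)
      rw [setIntegral_mul_eq_integral_indicator hΩ.measurableSet,
        setIntegral_mul_eq_integral_indicator hΩ.measurableSet] at h1
      simp only [fderiv_comp_sub_const] at h1
      rw [integral_neg, h1, neg_neg, ← integral_add_right_eq_self _ (t • h)]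
      refine integral_congr_ae (Eventually.of_forall fun x => ?_)
      simp only [add_sub_cancel_right]
      ring
    have i1 : Integrable (Function.uncurry fun (x : Space d) (t : ℝ) =>
        -(f' x * fderiv ℝ φ (x - t • h) h)) (volume.prod (volume.restrict (Ioc (0 : ℝ) 1))) := by
      have : Integrable (fun z : Space d × ℝ => f' z.1)
        (volume.prod (volume.restrict (Ioc (0 : ℝ) 1))) := hf'i.comp_fst _
      refine (this.mul_bdd (c := C') ?_ (Eventually.of_forall fun z => hC' _)).neg
      exact (hψ.1.continuous.comp (by fun_prop)).aestronglyMeasurable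
    have i2 : Integrable (Function.uncurry fun (t : ℝ) (x : Space d) =>
        φ x * G' (x + t • h)) ((volume.restrict (Ioc (0 : ℝ) 1)).prod volume) := by
      refine hsh.bdd_mul (c := C) ?_ (Eventually.of_forall fun z => hC _)
      exact (hφ1.continuous.comp continuous_snd).aestronglyMeasurable
    have e4 : ∫ x, f' x * (φ (x - h) - φ x) = ∫ x, φ x * P x := by
      calc ∫ x, f' x * (φ (x - h) - φ x)
          = ∫ x, ∫ t in Ioc (0 : ℝ) 1, -(f' x * fderiv ℝ φ (x - t • h) h) := by simp only [e2]
        _ = ∫ t in Ioc (0 : ℝ) 1, ∫ x, -(f' x * fderiv ℝ φ (x - t • h) h) :=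
            integral_integral_swap i1
        _ = ∫ t in Ioc (0 : ℝ) 1, ∫ x, φ x * G' (x + t • h) :=
            setIntegral_congr_fun measurableSet_Ioc e3
        _ = ∫ x, ∫ t in Ioc (0 : ℝ) 1, φ x * G' (x + t • h) := integral_integral_swap i2
        _ = ∫ x, φ x * P x := by simp only [integral_const_mul, hP]
    have e5 : ∫ x, f' x * (φ (x - h) - φ x) = (∫ x, φ x * f' (x + h)) - ∫ x, φ x * f' x := by
      have i3 : Integrable fun x => φ (x - h) * f' x :=
        hf'i.bdd_mul (hφ1.continuous.comp (by fun_prop)).aestronglyMeasurable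
          (Eventually.of_forall fun x => hC _)
      rw [e1, ← integral_sub i3 (hmul f' hf'i)]
      exact integral_congr_ae (Eventually.of_forall fun x => by simp only; ring)
    have e6 : ∫ x, φ x • (f' (x + h) - f' x - P x) =
        (∫ x, φ x * f' (x + h)) - (∫ x, φ x * f' x) - ∫ x, φ x * P x := by
      have i4 : Integrable fun x => φ x * f' (x + h) - φ x * f' x :=
        (hmul _ hfti).sub (hmul _ hf'i)
      rw [← integral_sub (hmul _ hfti) (hmul _ hf'i), ← integral_sub i4 (hmul _ hPi)]
      refine integral_congr_ae (Eventually.of_forall fun x => ?_)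
      simp only [smul_eq_mul]
      ring
    rw [e6, ← e5, e4, sub_self]
  filter_upwards [key] with x hx h1 h2
  have := hx ⟨h1, h2⟩
  rw [hf', indicator_of_mem h2, indicator_of_mem h1] at this
  linarith

/-- Jensen's inequality for powers. -/
theorem lintegral_rpow_le_lintegral_rpow {α : Type*} [MeasurableSpace α] {ν : Measure α}
    [IsProbabilityMeasure ν] {p : ℝ} (hp : 1 ≤ p) {a : α → ℝ} (ha : AEStronglyMeasurable a ν) :
    (∫⁻ t, ‖a t‖ₑ ∂ν) ^ p ≤ ∫⁻ t, ‖a t‖ₑ ^ p ∂ν := by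
  have h := eLpNorm'_le_eLpNorm'_of_exponent_le one_pos hp ν ha
  have hp0 : 0 < p := by linarith
  rw [eLpNorm'_eq_lintegral_enorm, eLpNorm'_eq_lintegral_enorm] at h
  simp only [ENNReal.rpow_one, div_one] at h
  calc _ ≤ ((∫⁻ t, ‖a t‖ₑ ^ p ∂ν) ^ (1 / p)) ^ p := ENNReal.rpow_le_rpow h hp0.le
    _ = _ := by rw [← ENNReal.rpow_mul, one_div_mul_cancel hp0.ne', ENNReal.rpow_one]

/-- Averaging over the translates along a segment does not increase the `L^p` norm. -/
theorem lintegral_segmentAverage_rpow_le {p : ℝ} (hp : 1 ≤ p) {G : Space d → ℝ}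
    (hG : Integrable G) (h : Space d) :
    ∫⁻ x, ‖∫ t in Ioc (0 : ℝ) 1, G (x + t • h)‖ₑ ^ p ≤ ∫⁻ x, ‖G x‖ₑ ^ p := by
  have hprob : IsProbabilityMeasure (volume.restrict (Ioc (0 : ℝ) 1)) := ⟨by simp⟩
  have hsh := (integrable_shear hG h).aestronglyMeasurable
  have hsw := hsh.prod_swap
  calc ∫⁻ x, ‖∫ t in Ioc (0 : ℝ) 1, G (x + t • h)‖ₑ ^ p
      ≤ ∫⁻ x, ∫⁻ t in Ioc (0 : ℝ) 1, ‖G (x + t • h)‖ₑ ^ p := by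
        refine lintegral_mono_ae ?_
        filter_upwards [hsw.prodMk_left] with x hx
        exact (ENNReal.rpow_le_rpow (enorm_integral_le_lintegral_enorm _) (by linarith)).trans
          (lintegral_rpow_le_lintegral_rpow hp hx)
    _ = ∫⁻ t in Ioc (0 : ℝ) 1, ∫⁻ x, ‖G (x + t • h)‖ₑ ^ p :=
        lintegral_lintegral_swap (hsw.enorm.pow_const p)
    _ = ∫⁻ _ in Ioc (0 : ℝ) 1, ∫⁻ x, ‖G x‖ₑ ^ p := by
        refine lintegral_congr fun t => ?_
        exact lintegral_add_right_eq_self (fun x => ‖G x‖ₑ ^ p) (t • h)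
    _ = ∫⁻ x, ‖G x‖ₑ ^ p := by simp

end Translation

/-! ### Poincaré inequalities on the ball -/

section Poincare

variable {d : ℕ}

theorem lintegral_rpow_enorm_eq {α : Type*} [MeasurableSpace α] {μ : Measure α} {p : ℝ}
    (hp : 1 < p) (f : α → ℝ) :
    ∫⁻ x, ‖f x‖ₑ ^ p ∂μ = eLpNorm f (ENNReal.ofReal p) μ ^ p := by
  have hp0 : 0 < p := by linarith
  rw [eLpNorm_eq_lintegral_rpow_enorm_toReal (by simp; linarith) (by simp),
    ENNReal.toReal_ofReal hp0.le, ← ENNReal.rpow_mul, one_div_mul_cancel hp0.ne', ENNReal.rpow_one]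

theorem eLpNorm_le_of_lintegral_rpow_le {α β : Type*} [MeasurableSpace α] [MeasurableSpace β]
    {μ : Measure α} {ν : Measure β} {p : ℝ} (hp : 1 < p) {f : α → ℝ} {g : β → ℝ} {K : ℝ≥0∞}
    (h : ∫⁻ x, ‖f x‖ₑ ^ p ∂μ ≤ K * ∫⁻ x, ‖g x‖ₑ ^ p ∂ν) :
    eLpNorm f (ENNReal.ofReal p) μ ≤ K ^ (1 / p) * eLpNorm g (ENNReal.ofReal p) ν := by
  have hp0 : 0 < p := by linarith
  rw [lintegral_rpow_enorm_eq hp, lintegral_rpow_enorm_eq hp] at h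
  have h1 := ENNReal.rpow_le_rpow h (show 0 ≤ 1 / p by positivity)
  rwa [ENNReal.mul_rpow_of_nonneg _ _ (by positivity), ← ENNReal.rpow_mul, ← ENNReal.rpow_mul,
    mul_one_div_cancel hp0.ne', ENNReal.rpow_one, ENNReal.rpow_one] at h1

/-- A function of mean zero is controlled by its increments. -/
theorem enorm_rpow_le_lintegral_sub {α : Type*} [MeasurableSpace α] {ν : Measure α}
    [IsProbabilityMeasure ν] {p : ℝ} (hp : 1 ≤ p) {f : α → ℝ} (hf : Integrable f ν)
    (h0 : ∫ y, f y ∂ν = 0) (c : ℝ) : ‖c‖ₑ ^ p ≤ ∫⁻ y, ‖f y - c‖ₑ ^ p ∂ν := by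
  have h1 : ∫ y, (f y - c) ∂ν = -c := by
    rw [integral_sub hf (integrable_const c), h0]
    simp
  have h2 : ‖c‖ₑ ≤ ∫⁻ y, ‖f y - c‖ₑ ∂ν := by
    rw [← enorm_neg, ← h1]
    exact enorm_integral_le_lintegral_enorm _
  exact (ENNReal.rpow_le_rpow h2 (by linarith)).trans
    (lintegral_rpow_le_lintegral_rpow hp (hf.1.sub aestronglyMeasurable_const))

instance isFiniteMeasure_restrict_unitBall : IsFiniteMeasure (volume.restrict (unitBall d)) :=
  ⟨by simpa using measure_ball_lt_top⟩

theorem MemLpOn.integrableOn {p : ℝ} (hp : 1 < p) {f : Space d → ℝ}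
    (hf : MemLpOn p (unitBall d) f) : IntegrableOn f (unitBall d) :=
  MemLp.integrable (ENNReal.one_le_ofReal.2 hp.le) hf

/-- The increments by a vector `h` of length at most `2`, over the points of the ball that `h` keeps
in the ball, are bounded in `L^p` by the gradient. -/
theorem lintegral_increment_le {p : ℝ} (hp : 1 < p) {f : Space d → ℝ} {G : Fin d → Space d → ℝ}
    (hf : MemLpOn p (unitBall d) f)
    (hG : ∀ i, HasWeakPartial (unitBall d) i f (G i) ∧ MemLpOn p (unitBall d) (G i))
    (h : Space d) (hh : ‖h‖ ≤ 2) :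
    ∫⁻ x, (unitBall d).indicator 1 x * (unitBall d).indicator 1 (x + h) *
        ‖(unitBall d).indicator f (x + h) - (unitBall d).indicator f x‖ₑ ^ p ≤
      ∫⁻ x in unitBall d, ‖2 * ∑ i, |G i x|‖ₑ ^ p := by
  have hB : MeasurableSet (unitBall d) := measurableSet_ball
  have hfi := hf.integrableOn hp
  have hGi := fun i => (hG i).2.integrableOn hp
  set Gh : Space d → ℝ := fun x => ∑ i, h i * G i x with hGh
  have hGhi : IntegrableOn Gh (unitBall d) :=
    integrable_finsetSum _ fun i _ => (hGi i).const_mul (h i)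
  have hae := ae_sub_eq_integral_weakDeriv Metric.isOpen_ball (convex_ball 0 1) hfi hGhi (h := h)
    fun φ hφ => setIntegral_mul_fderiv (fun i => (hG i).1) hφ h
      hfi.locallyIntegrableOn
  calc _ ≤ ∫⁻ x, ‖∫ t in Ioc (0 : ℝ) 1, (unitBall d).indicator Gh (x + t • h)‖ₑ ^ p := by
        refine lintegral_mono_ae ?_
        filter_upwards [hae] with x hx
        by_cases h1 : x ∈ unitBall d
        · by_cases h2 : x + h ∈ unitBall d
          · simp only [indicator_of_mem h1, indicator_of_mem h2, Pi.one_apply, one_mul]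
            rw [hx h1 h2]
          · simp only [indicator_of_notMem h2, mul_zero, zero_mul, zero_le]
        · simp only [indicator_of_notMem h1, zero_mul, zero_le]
    _ ≤ ∫⁻ x, ‖(unitBall d).indicator Gh x‖ₑ ^ p :=
        lintegral_segmentAverage_rpow_le hp.le (hGhi.integrable_indicator hB) h
    _ = ∫⁻ x in unitBall d, ‖Gh x‖ₑ ^ p := by
        rw [← lintegral_indicator hB]
        refine lintegral_congr fun x => ?_
        by_cases hx : x ∈ unitBall d
        · simp [hx]
        · simp only [indicator_of_notMem hx, enorm_zero]
          exact ENNReal.zero_rpow_of_pos (by linarith)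
    _ ≤ _ := by
        refine lintegral_mono fun x => ENNReal.rpow_le_rpow ?_ (by linarith)
        rw [Real.enorm_eq_ofReal_abs, Real.enorm_eq_ofReal_abs]
        refine ENNReal.ofReal_le_ofReal ?_
        calc |Gh x| ≤ ∑ i, |h i * G i x| := Finset.abs_sum_le_sum_abs _ _
          _ ≤ ∑ i, 2 * |G i x| := by
            refine Finset.sum_le_sum fun i _ => ?_
            rw [abs_mul]
            gcongr
            exact (PiLp.norm_apply_le h i).trans hh
          _ = 2 * ∑ i, |G i x| := (Finset.mul_sum _ _ _).symm
          _ ≤ _ := le_abs_self _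

theorem eLpNorm_two_mul_sum_abs_le {α ι : Type*} [MeasurableSpace α] [Fintype ι] {μ : Measure α}
    {q : ℝ≥0∞} (hq : 1 ≤ q) {G : ι → α → ℝ} (hG : ∀ i, MemLp (G i) q μ) :
    eLpNorm (fun x => 2 * ∑ i, |G i x|) q μ ≤ 2 * ∑ i, eLpNorm (G i) q μ := by
  have h1 : eLpNorm (fun x => 2 * ∑ i, |G i x|) q μ =
      2 * eLpNorm (fun x => ∑ i, |G i x|) q μ := by
    have := eLpNorm_const_smul (2 : ℝ) (fun x => ∑ i, |G i x|) q μ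
    simp only [Real.enorm_eq_ofReal_abs] at this
    norm_num at this
    rw [← this]
    rfl
  rw [h1]
  gcongr
  have h2 := eLpNorm_sum_le (μ := μ) (p := q) (s := Finset.univ) (f := fun i x => |G i x|)
    (fun i _ => (hG i).1.norm) hq
  have h3 : (∑ i, fun x => |G i x|) = fun x => ∑ i, |G i x| := by
    ext x; simp
  rw [h3] at h2
  refine h2.trans (Finset.sum_le_sum fun i _ => ?_)
  exact (eLpNorm_norm (G i)).le

theorem aestronglyMeasurable_comp_add {f : Space d → ℝ} (hf : AEStronglyMeasurable f volume) :
    AEStronglyMeasurable (fun z : Space d × Space d => f (z.1 + z.2)) (volume.prod volume) := by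
  have hmp : MeasurePreserving (fun z : Space d × Space d => (z.1, z.1 + z.2))
      (volume.prod volume) (volume.prod volume) := by
    refine (MeasurePreserving.id _).skew_product (g := fun x y => x + y) measurable_add ?_
    exact Eventually.of_forall fun t => (measurePreserving_add_left volume t).map_eq
  have h : AEStronglyMeasurable (fun z : Space d × Space d => f z.2) (volume.prod volume) :=
    hf.comp_snd
  exact h.comp_measurePreserving hmp

/-- The Poincaré inequality for functions of mean zero in `W^{1,p}` of the unit ball. The increment
estimate for a fixed translation `h` is integrated over `|h| < 2`. -/
theorem exists_poincare_mean_zero (d : ℕ) {p : ℝ} (hp : 1 < p) : ∃ C : ℝ≥0∞, C ≠ ⊤ ∧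
    ∀ (f : Space d → ℝ) (G : Fin d → Space d → ℝ), MemLpOn p (unitBall d) f →
      (∀ i, HasWeakPartial (unitBall d) i f (G i) ∧ MemLpOn p (unitBall d) (G i)) →
      ∫ x in unitBall d, f x = 0 →
      eLpNorm f (ENNReal.ofReal p) (volume.restrict (unitBall d)) ≤
        C * ∑ i, eLpNorm (G i) (ENNReal.ofReal p) (volume.restrict (unitBall d)) := by
  have hp0 : 0 < p := by linarith
  have hB : MeasurableSet (unitBall d) := measurableSet_ball
  set V := volume (unitBall d) with hV
  have hV0 : V ≠ 0 := (Metric.measure_ball_pos volume _ one_pos).ne'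
  have hVt : V ≠ ⊤ := measure_ball_lt_top.ne
  set W := volume (Metric.ball (0 : Space d) 2) with hW
  have hWt : W ≠ ⊤ := measure_ball_lt_top.ne
  have hK : V⁻¹ * W ≠ ⊤ := ENNReal.mul_ne_top (by simpa using hV0) hWt
  refine ⟨(V⁻¹ * W) ^ (1 / p) * 2, ENNReal.mul_ne_top
    (ENNReal.rpow_ne_top_of_nonneg (by positivity) hK) (by simp), ?_⟩
  intro f G hf hG h0
  set f' := (unitBall d).indicator f with hf'
  have hf'm : AEStronglyMeasurable f' volume :=
    ((hf.integrableOn hp).integrable_indicator hB).aestronglyMeasurable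
  set k : Space d → ℝ≥0∞ := (unitBall d).indicator 1 with hk
  have hkm : Measurable k := measurable_one.indicator hB
  have h1 : ∀ x, ‖f x‖ₑ ^ p ≤ V⁻¹ * ∫⁻ y in unitBall d, ‖f y - f x‖ₑ ^ p := by
    intro x
    have hprob : IsProbabilityMeasure (V⁻¹ • volume.restrict (unitBall d)) :=
      ⟨by simp [← hV, ENNReal.inv_mul_cancel hV0 hVt]⟩
    have := enorm_rpow_le_lintegral_sub (ν := V⁻¹ • volume.restrict (unitBall d)) hp.le
      (f := f) ((hf.integrableOn hp).smul_measure (by simpa using hV0))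
      (by rw [integral_smul_measure, h0, smul_zero]) (f x)
    rwa [lintegral_smul_measure, smul_eq_mul] at this
  have h2 : ∀ x, k x * ∫⁻ y in unitBall d, ‖f y - f x‖ₑ ^ p =
      ∫⁻ h, k x * k (x + h) * ‖f' (x + h) - f' x‖ₑ ^ p := by
    intro x
    rw [lintegral_add_left_eq_self (fun y => k x * k y * ‖f' y - f' x‖ₑ ^ p) x,
      ← lintegral_indicator hB]
    have hkx : k x ≠ ⊤ := by
      by_cases hx : x ∈ unitBall d <;> simp [hk, hx]
    rw [← lintegral_const_mul' _ _ hkx]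
    refine lintegral_congr fun y => ?_
    by_cases hx : x ∈ unitBall d
    · by_cases hy : y ∈ unitBall d
      · simp [hk, hf', hx, hy]
      · simp [hk, hy]
    · simp [hk, hx]
  have hmeas : AEMeasurable (Function.uncurry fun x h : Space d =>
      k x * k (x + h) * ‖f' (x + h) - f' x‖ₑ ^ p) (volume.prod volume) := by
    have hA := aestronglyMeasurable_comp_add hf'm
    have hB : AEStronglyMeasurable (fun z : Space d × Space d => f' z.1)
      (volume.prod volume) := hf'm.comp_fst
    refine ((hkm.comp measurable_fst).mul (hkm.comp measurable_add)).aemeasurable.mul ?_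
    exact ((hA.sub hB).enorm).pow_const p
  have h3 : ∫⁻ x in unitBall d, ‖f x‖ₑ ^ p ≤
      V⁻¹ * W * ∫⁻ x in unitBall d, ‖2 * ∑ i, |G i x|‖ₑ ^ p := by
    calc ∫⁻ x in unitBall d, ‖f x‖ₑ ^ p
        ≤ ∫⁻ x in unitBall d, V⁻¹ * ∫⁻ y in unitBall d, ‖f y - f x‖ₑ ^ p :=
          lintegral_mono h1
      _ = V⁻¹ * ∫⁻ x, k x * ∫⁻ y in unitBall d, ‖f y - f x‖ₑ ^ p := by
          rw [lintegral_const_mul' _ _ (by simpa using hV0), ← lintegral_indicator hB]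
          congr 1
          refine lintegral_congr fun x => ?_
          by_cases hx : x ∈ unitBall d <;> simp [hk, hx]
      _ = V⁻¹ * ∫⁻ x, ∫⁻ h, k x * k (x + h) * ‖f' (x + h) - f' x‖ₑ ^ p := by
          simp only [h2]
      _ = V⁻¹ * ∫⁻ h, ∫⁻ x, k x * k (x + h) * ‖f' (x + h) - f' x‖ₑ ^ p := by
          rw [lintegral_lintegral_swap hmeas]
      _ ≤ V⁻¹ * ∫⁻ h, (Metric.ball (0 : Space d) 2).indicator
            (fun _ => ∫⁻ x in unitBall d, ‖2 * ∑ i, |G i x|‖ₑ ^ p) h := by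
          gcongr with h
          by_cases hh : h ∈ Metric.ball (0 : Space d) 2
          · rw [indicator_of_mem hh]
            exact lintegral_increment_le hp hf hG h (by simpa using (mem_ball_zero_iff.1 hh).le)
          · -- two points of the unit ball differ by less than `2`
            rw [indicator_of_notMem hh]
            refine le_of_eq ((lintegral_congr fun x => ?_).trans lintegral_zero)
            by_cases hx : x ∈ unitBall d
            · have hxh : x + h ∉ unitBall d := fun hxh => hh (by
                rw [mem_ball_zero_iff] at hx hxh ⊢
                calc ‖h‖ = ‖(x + h) - x‖ := by simp
                  _ ≤ ‖x + h‖ + ‖x‖ := norm_sub_le _ _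
                  _ < 2 := by linarith)
              simp [hk, hxh]
            · simp [hk, hx]
      _ = _ := by
          rw [lintegral_indicator measurableSet_ball, lintegral_const]
          simp only [Measure.restrict_apply_univ]
          rw [← hW]
          ring
  calc _ ≤ (V⁻¹ * W) ^ (1 / p) * eLpNorm (fun x => 2 * ∑ i, |G i x|) (ENNReal.ofReal p)
        (volume.restrict (unitBall d)) := eLpNorm_le_of_lintegral_rpow_le hp h3
    _ ≤ (V⁻¹ * W) ^ (1 / p) * (2 * ∑ i, eLpNorm (G i) (ENNReal.ofReal p)
        (volume.restrict (unitBall d))) := by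
        gcongr
        exact eLpNorm_two_mul_sum_abs_le (ENNReal.one_le_ofReal.2 hp.le) fun i => (hG i).2
    _ = _ := by ring

/-- The Poincaré inequality for test functions: a translation of length `2` moves every point out
of the unit ball. -/
theorem IsTestFunction.eLpNorm_le {p : ℝ} (hp : 1 < p) {φ : Space d → ℝ}
    (hφ : IsTestFunction (unitBall d) φ) (i : Fin d) :
    eLpNorm φ (ENNReal.ofReal p) (volume.restrict (unitBall d)) ≤
      2 * eLpNorm (partialDeriv i φ) (ENNReal.ofReal p) (volume.restrict (unitBall d)) := by
  have hp0 : 0 < p := by linarith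
  set h : Space d := (2 : ℝ) • EuclideanSpace.single i 1 with hh
  have hnorm : ‖h‖ = 2 := by simp [hh, norm_smul]
  have hψ := hφ.directionalDeriv h
  have hψi : Integrable fun x => fderiv ℝ φ x h :=
    hψ.1.continuous.integrable_of_hasCompactSupport hψ.2.1
  have h1 : ∫⁻ x in unitBall d, ‖φ x‖ₑ ^ p ≤
      1 * ∫⁻ x in unitBall d, ‖fderiv ℝ φ x h‖ₑ ^ p := by
    calc ∫⁻ x in unitBall d, ‖φ x‖ₑ ^ p
        = ∫⁻ x in unitBall d, ‖∫ t in Ioc (0 : ℝ) 1, fderiv ℝ φ (x + t • h) h‖ₑ ^ p := by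
          refine setLIntegral_congr_fun measurableSet_ball fun x hx => ?_
          have hxh : x + h ∉ unitBall d := fun hxh => by
            rw [mem_ball_zero_iff] at hx hxh
            have : ‖h‖ ≤ ‖x + h‖ + ‖x‖ := by
              simpa using norm_sub_le (x + h) x
            linarith
          rw [← sub_eq_integral_fderiv hφ.1, hφ.eq_zero hxh, zero_sub, enorm_neg]
      _ ≤ ∫⁻ x, ‖∫ t in Ioc (0 : ℝ) 1, fderiv ℝ φ (x + t • h) h‖ₑ ^ p :=
          setLIntegral_le_lintegral _ _
      _ ≤ ∫⁻ x, ‖fderiv ℝ φ x h‖ₑ ^ p := lintegral_segmentAverage_rpow_le hp.le hψi h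
      _ = ∫⁻ x in unitBall d, ‖fderiv ℝ φ x h‖ₑ ^ p := by
          rw [← lintegral_indicator measurableSet_ball]
          refine lintegral_congr fun x => ?_
          by_cases hx : x ∈ unitBall d
          · simp [hx]
          · rw [indicator_of_notMem hx, hψ.eq_zero hx, enorm_zero, ENNReal.zero_rpow_of_pos hp0]
      _ = _ := (one_mul _).symm
  have h2 := eLpNorm_le_of_lintegral_rpow_le hp h1
  rw [ENNReal.one_rpow, one_mul] at h2
  refine h2.trans (le_of_eq ?_)
  have h3 : (fun x => fderiv ℝ φ x h) = (2 : ℝ) • partialDeriv i φ := by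
    ext x
    simp [hh, partialDeriv]
  rw [h3, eLpNorm_const_smul, Real.enorm_eq_ofReal_abs]
  norm_num

end Poincare

/-! ### The weak Hessian of a convex function -/

section ConvexHessian

variable {d : ℕ} {Ω : Set (Space d)}

/-- A function whose integral against every nonnegative test function is nonnegative is
nonnegative almost everywhere: its mollifications are nonnegative and converge to it. -/
theorem ae_nonneg_of_forall_testFunction (hΩ : IsOpen Ω) {f : Space d → ℝ} (hf : IntegrableOn f Ω)
    (h : ∀ φ, IsTestFunction Ω φ → (∀ x, 0 ≤ φ x) → 0 ≤ ∫ x in Ω, f x * φ x) :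
    ∀ᵐ x ∂(volume.restrict Ω), 0 ≤ f x := by
  let b : ℕ → ContDiffBump (0 : Space d) := fun n =>
    { rIn := 1 / ((n : ℝ) + 1)
      rOut := 2 * (1 / ((n : ℝ) + 1))
      rIn_pos := by positivity
      rIn_lt_rOut := by
        have : (0 : ℝ) < 1 / ((n : ℝ) + 1) := by positivity
        linarith }
  have hb : Tendsto (fun n => (b n).rOut) atTop (𝓝 0) := by
    have := (tendsto_one_div_add_atTop_nhds_zero_nat (𝕜 := ℝ)).const_mul 2
    rwa [mul_zero] at this
  have hconv := ContDiffBump.ae_convolution_tendsto_right_of_locallyIntegrable (μ := volume)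
    (K := 2) hb (Eventually.of_forall fun n => le_rfl)
    (hf.integrable_indicator hΩ.measurableSet).locallyIntegrable
  rw [ae_restrict_iff' hΩ.measurableSet]
  filter_upwards [hconv] with x hx hxΩ
  rw [indicator_of_mem hxΩ] at hx
  refine ge_of_tendsto hx ?_
  obtain ⟨ε, hε, hball⟩ := Metric.isOpen_iff.1 hΩ x hxΩ
  filter_upwards [hb.eventually (gt_mem_nhds hε)] with n hn
  set ψ : Space d → ℝ := (b n).normed volume with hψ
  have h1 : IsTestFunction (Metric.closedBall 0 (b n).rOut) ψ :=
    ⟨(b n).contDiff_normed, (b n).hasCompactSupport_normed, (b n).tsupport_normed_eq.subset⟩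
  have h2 : IsTestFunction Ω fun y => ψ (y - x) := h1.comp_sub fun y hy => hball (by
    rw [mem_closedBall_zero_iff] at hy
    rw [Metric.mem_ball, dist_eq_norm, add_sub_cancel_right]
    exact hy.trans_lt hn)
  have h3 := h _ h2 fun y => (b n).nonneg_normed _
  rw [setIntegral_mul_eq_integral_indicator hΩ.measurableSet] at h3
  refine h3.trans (le_of_eq ?_)
  rw [convolution_def, ← integral_sub_left_eq_self _ volume x]
  refine integral_congr_ae (Eventually.of_forall fun y => ?_)
  simp only [ContinuousLinearMap.lsmul_apply, smul_eq_mul]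
  rw [mul_comm, hψ, ← (b n).normed_neg, neg_sub, sub_sub_cancel]

theorem tendsto_integral_differenceQuotient {f φ : Space d → ℝ} (hf : Integrable f)
    (hφ : ContDiff ℝ ∞ φ) (hφc : HasCompactSupport φ) (h : Space d) :
    Tendsto (fun s : ℝ => ∫ x, f x * (s⁻¹ * (φ (x + s • h) - φ x))) (𝓝[>] 0)
      (𝓝 (∫ x, f x * fderiv ℝ φ x h)) := by
  obtain ⟨C, hC⟩ := ContDiff.lipschitzWith_of_hasCompactSupport hφc hφ (by simp)
  refine tendsto_integral_filter_of_dominated_convergence (fun x => ‖f x‖ * (C * ‖h‖)) ?_ ?_ ?_ ?_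
  · refine Eventually.of_forall fun s => hf.1.mul ?_
    exact (continuous_const.mul ((hφ.continuous.comp (by fun_prop)).sub
      hφ.continuous)).aestronglyMeasurable
  · filter_upwards [self_mem_nhdsWithin] with s hs
    refine Eventually.of_forall fun x => ?_
    rw [norm_mul]
    gcongr
    have hs0 : (0 : ℝ) < s := hs
    have h1 := hC.norm_sub_le (x + s • h) x
    rw [add_sub_cancel_left, norm_smul, Real.norm_of_nonneg hs0.le] at h1
    rw [norm_mul, norm_inv, Real.norm_of_nonneg hs0.le, inv_mul_le_iff₀ hs0]
    linarith
  · exact hf.norm.mul_const _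
  · refine Eventually.of_forall fun x => Tendsto.const_mul _ ?_
    have h1 : HasDerivAt (fun t : ℝ => φ (x + t • h)) (fderiv ℝ φ x h) 0 := by
      have h2 : HasDerivAt (fun t : ℝ => x + t • h) h 0 := by
        simpa using ((hasDerivAt_id (0 : ℝ)).smul_const h).const_add x
      have h3 : HasFDerivAt φ (fderiv ℝ φ x) (x + (0 : ℝ) • h) := by
        simpa using (hφ.differentiable (by simp)).differentiableAt.hasFDerivAt
      exact h3.comp_hasDerivAt 0 h2
    simpa using h1.tendsto_slope_zero_right

/-- Opposite vertices of a degenerate parallelogram: a convex function has a larger sum at the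
outer points than at the inner ones. -/
theorem convexOn_add_le_add_outer {u : Space d → ℝ} (hu : ConvexOn ℝ Ω u) {x h : Space d}
    {s t : ℝ} (hs : 0 < s) (ht : 0 < t) (hx : x ∈ Ω) (hxst : x - (s + t) • h ∈ Ω) :
    u (x - s • h) + u (x - t • h) ≤ u x + u (x - (s + t) • h) := by
  have hst : 0 < s + t := add_pos hs ht
  have hsum : t / (s + t) + s / (s + t) = 1 := by field_simp; ring
  have h1 := hu.2 hx hxst (show 0 ≤ t / (s + t) by positivity)
    (show 0 ≤ s / (s + t) by positivity) hsum
  have h2 := hu.2 hx hxst (show 0 ≤ s / (s + t) by positivity)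
    (show 0 ≤ t / (s + t) by positivity)
    (by rw [add_comm, hsum])
  have e1 : (t / (s + t)) • x + (s / (s + t)) • (x - (s + t) • h) = x - s • h := by
    rw [smul_sub, smul_smul, div_mul_cancel₀ _ hst.ne', ← add_sub_assoc, ← add_smul, hsum, one_smul]
  have e2 : (s / (s + t)) • x + (t / (s + t)) • (x - (s + t) • h) = x - t • h := by
    rw [smul_sub, smul_smul, div_mul_cancel₀ _ hst.ne', ← add_sub_assoc, ← add_smul,
      add_comm (s / (s + t)), hsum, one_smul]
  rw [e1] at h1
  rw [e2] at h2
  simp only [smul_eq_mul] at h1 h2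
  have h3 : t / (s + t) = 1 - s / (s + t) := by linarith
  rw [h3] at h1 h2
  linarith

theorem exists_forall_add_smul_mem (hΩ : IsOpen Ω) {K : Set (Space d)} (hK : IsCompact K)
    (hKΩ : K ⊆ Ω) (h : Space d) : ∃ δ > 0, ∀ r : ℝ, |r| < δ → ∀ x ∈ K, x + r • h ∈ Ω := by
  obtain ⟨ε, hε, hsub⟩ := hK.exists_thickening_subset_open hΩ hKΩ
  refine ⟨ε / (‖h‖ + 1), by positivity, fun r hr x hx => hsub ?_⟩
  rw [Metric.mem_thickening_iff]
  refine ⟨x, hx, ?_⟩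
  rw [dist_eq_norm, add_sub_cancel_left, norm_smul, Real.norm_eq_abs]
  rw [lt_div_iff₀ (by positivity)] at hr
  nlinarith [abs_nonneg r, norm_nonneg h]

/-- The second weak derivative of a convex function in a direction `h` is nonnegative. Both weak
derivatives are written as limits of difference quotients of the test function, which are moved to
the convex function by translation invariance. -/
theorem ae_nonneg_of_convexOn (hΩ : IsOpen Ω) {u G H : Space d → ℝ} (hu : ConvexOn ℝ Ω u)
    (hui : IntegrableOn u Ω) (hGi : IntegrableOn G Ω) (hHi : IntegrableOn H Ω) {h : Space d}
    (huG : ∀ φ, IsTestFunction Ω φ →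
      ∫ x in Ω, u x * fderiv ℝ φ x h = -∫ x in Ω, G x * φ x)
    (hGH : ∀ φ, IsTestFunction Ω φ →
      ∫ x in Ω, G x * fderiv ℝ φ x h = -∫ x in Ω, H x * φ x) :
    ∀ᵐ x ∂(volume.restrict Ω), 0 ≤ H x := by
  refine ae_nonneg_of_forall_testFunction hΩ hHi fun φ hφ hφ0 => ?_
  set u' := Ω.indicator u with hu'
  set G' := Ω.indicator G with hG'
  have hu'i : Integrable u' := hui.integrable_indicator hΩ.measurableSet
  have hG'i : Integrable G' := hGi.integrable_indicator hΩ.measurableSet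
  obtain ⟨δ, hδ, hmem⟩ := exists_forall_add_smul_mem hΩ hφ.2.1 hφ.2.2 h
  have hsmall : ∀ᶠ s : ℝ in 𝓝[>] 0, 0 < s ∧ s < δ / 2 := by
    filter_upwards [Ioo_mem_nhdsGT (show (0 : ℝ) < δ / 2 by positivity)] with s hs
    exact hs
  have e1 : ∫ x in Ω, H x * φ x = -∫ x, G' x * fderiv ℝ φ x h := by
    rw [← setIntegral_mul_eq_integral_indicator hΩ.measurableSet, hGH φ hφ, neg_neg]
  rw [e1, neg_nonneg]
  -- move one derivative from `φ` to `u` at a time, first with step `s`, then with step `t`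
  refine le_of_tendsto (tendsto_integral_differenceQuotient hG'i hφ.1 hφ.2.1 h) ?_
  filter_upwards [hsmall] with s hs
  have hφK : IsTestFunction (tsupport φ) φ := ⟨hφ.1, hφ.2.1, subset_rfl⟩
  have hχ : IsTestFunction Ω fun x => s⁻¹ * (φ (x + s • h) - φ x) := by
    refine IsTestFunction.const_mul _ (IsTestFunction.sub ?_ hφ)
    have := hφK.comp_sub (Ω := Ω) (v := -(s • h)) fun x hx => by
      rw [← neg_smul]
      exact hmem _ (by rw [abs_neg, abs_of_pos hs.1]; linarith) x hx
    simpa using this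
  have e2 := huG _ hχ
  rw [setIntegral_mul_eq_integral_indicator hΩ.measurableSet,
    setIntegral_mul_eq_integral_indicator hΩ.measurableSet] at e2
  have e3 : ∫ x, G' x * (s⁻¹ * (φ (x + s • h) - φ x)) =
      -∫ x, u' x * fderiv ℝ (fun x => s⁻¹ * (φ (x + s • h) - φ x)) x h := by
    rw [e2, neg_neg]
  rw [e3, neg_nonpos]
  refine ge_of_tendsto (tendsto_integral_differenceQuotient hu'i hχ.1 hχ.2.1 h) ?_
  filter_upwards [hsmall] with t ht
  obtain ⟨C, hC⟩ := hφ.exists_bound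
  have hi : ∀ v : Space d, Integrable fun x => u' x * φ (x + v) := fun v =>
    hu'i.mul_bdd (hφ.1.continuous.comp (by fun_prop)).aestronglyMeasurable
      (Eventually.of_forall fun x => hC _)
  have hi' : ∀ v : Space d, Integrable fun x => u' (x - v) * φ x := fun v =>
    (hu'i.comp_sub_right v).mul_bdd hφ.1.continuous.aestronglyMeasurable
      (Eventually.of_forall fun x => hC _)
  have hshift : ∀ v : Space d, ∫ x, u' x * φ (x + v) = ∫ x, u' (x - v) * φ x := fun v => by
    rw [← integral_add_right_eq_self (fun x => u' (x - v) * φ x) v]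
    simp
  have e4 : ∫ x, u' x * (t⁻¹ * (s⁻¹ * (φ (x + t • h + s • h) - φ (x + t • h)) -
      s⁻¹ * (φ (x + s • h) - φ x))) = (t⁻¹ * s⁻¹) *
      ∫ x, ((u' (x - (s + t) • h) + u' (x - 0)) - (u' (x - t • h) + u' (x - s • h))) * φ x := by
    have e5 : ∀ x, u' x * (t⁻¹ * (s⁻¹ * (φ (x + t • h + s • h) - φ (x + t • h)) -
      s⁻¹ * (φ (x + s • h) - φ x))) = (t⁻¹ * s⁻¹) * ((u' x * φ (x + (s + t) • h) +
        u' x * φ (x + 0)) - (u' x * φ (x + t • h) + u' x * φ (x + s • h))) := fun x => by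
      have : x + t • h + s • h = x + (s + t) • h := by module
      rw [this, add_zero]
      ring
    simp only [e5]
    rw [integral_const_mul]
    congr 1
    have e6 : ∀ x, ((u' (x - (s + t) • h) + u' (x - 0)) - (u' (x - t • h) + u' (x - s • h))) * φ x
        = (u' (x - (s + t) • h) * φ x + u' (x - 0) * φ x) -
          (u' (x - t • h) * φ x + u' (x - s • h) * φ x) := fun x => by ring
    simp only [e6]
    rw [integral_sub (by exact (hi _).add (hi _)) (by exact (hi _).add (hi _)),
      integral_add (hi _) (hi _), integral_add (hi _) (hi _),
      integral_sub (by exact (hi' _).add (hi' _)) (by exact (hi' _).add (hi' _)),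
      integral_add (hi' _) (hi' _), integral_add (hi' _) (hi' _),
      hshift, hshift, hshift, hshift]
  rw [e4]
  have hst : 0 < t⁻¹ * s⁻¹ := mul_pos (inv_pos.2 ht.1) (inv_pos.2 hs.1)
  -- on the support of `φ` the four points lie in `Ω`, and convexity applies
  refine mul_nonneg hst.le (integral_nonneg fun x => ?_)
  by_cases hx : x ∈ tsupport φ
  · refine mul_nonneg ?_ (hφ0 x)
    have hm : ∀ r : ℝ, 0 ≤ r → r < δ → x - r • h ∈ Ω := fun r hr0 hr => by
      rw [sub_eq_add_neg, ← neg_smul]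
      exact hmem _ (by rwa [abs_neg, abs_of_nonneg hr0]) x hx
    have hx0 := hφ.2.2 hx
    have h1 := hm (s + t) (by linarith [hs.1, ht.1]) (by linarith [hs.2, ht.2])
    have h2 := hm t ht.1.le (by linarith [ht.2])
    have h3 := hm s hs.1.le (by linarith [hs.2])
    rw [sub_zero, hu', indicator_of_mem h1, indicator_of_mem h2, indicator_of_mem h3,
      indicator_of_mem hx0]
    linarith [convexOn_add_le_add_outer hu hs.1 ht.1 hx0 h1]
  · simp only [image_eq_zero_of_notMem_tsupport hx, mul_zero, le_refl, Pi.zero_apply]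

/-- The weak Hessian of a convex function is positive semidefinite almost everywhere. -/
theorem ae_posSemidef_of_convexOn (hΩ : IsOpen Ω) {u : Space d → ℝ} (hu : ConvexOn ℝ Ω u)
    {G : Fin d → Space d → ℝ} {H : Space d → SymMat d} (hG : ∀ i, HasWeakPartial Ω i u (G i))
    (hH : ∀ i j, HasWeakPartial Ω j (G i) fun x => (H x : Matrix (Fin d) (Fin d) ℝ) i j)
    (hui : IntegrableOn u Ω) (hGi : ∀ i, IntegrableOn (G i) Ω)
    (hHi : ∀ i j, IntegrableOn (fun x => (H x : Matrix (Fin d) (Fin d) ℝ) i j) Ω) :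
    ∀ᵐ x ∂(volume.restrict Ω), (H x : Matrix (Fin d) (Fin d) ℝ).PosSemidef := by
  have hdir : ∀ h : Space d, ∀ᵐ x ∂(volume.restrict Ω),
      0 ≤ ∑ i, h i * ∑ j, h j * (H x : Matrix (Fin d) (Fin d) ℝ) i j := by
    intro h
    have hGhi : IntegrableOn (fun x => ∑ i, h i * G i x) Ω :=
      integrable_finsetSum _ fun i _ => (hGi i).const_mul _
    have hHhi : ∀ i, IntegrableOn (fun x => ∑ j, h j * (H x : Matrix (Fin d) (Fin d) ℝ) i j) Ω :=
      fun i => integrable_finsetSum _ fun j _ => (hHi i j).const_mul _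
    refine ae_nonneg_of_convexOn hΩ hu hui hGhi
      (integrable_finsetSum _ fun i _ => (hHhi i).const_mul _)
      (fun φ hφ => setIntegral_mul_fderiv hG hφ h hui.locallyIntegrableOn) fun φ hφ => ?_
    have h1 : ∀ x, (∑ i, h i * G i x) * fderiv ℝ φ x h = ∑ i, h i * (G i x * fderiv ℝ φ x h) :=
      fun x => by rw [Finset.sum_mul]; exact Finset.sum_congr rfl fun i _ => by ring
    have h2 : ∀ x, (∑ i, h i * ∑ j, h j * (H x : Matrix (Fin d) (Fin d) ℝ) i j) * φ x =
        ∑ i, h i * ((∑ j, h j * (H x : Matrix (Fin d) (Fin d) ℝ) i j) * φ x) :=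
      fun x => by rw [Finset.sum_mul]; exact Finset.sum_congr rfl fun i _ => by ring
    simp only [h1, h2]
    rw [integral_finsetSum, integral_finsetSum, ← Finset.sum_neg_distrib]
    · refine Finset.sum_congr rfl fun i _ => ?_
      rw [integral_const_mul, integral_const_mul,
        setIntegral_mul_fderiv (hH i) hφ h (hGi i).locallyIntegrableOn, mul_neg]
    · exact fun i _ => (hφ.integrableOn_mul (hHhi i).locallyIntegrableOn).const_mul _
    · exact fun i _ => ((hφ.directionalDeriv h).integrableOn_mul
        (hGi i).locallyIntegrableOn).const_mul _
  -- one null set serves a dense sequence of directions, and continuity gives the others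
  have hall := ae_all_iff.2 fun n => hdir (TopologicalSpace.denseSeq (Space d) n)
  filter_upwards [hall] with x hx
  have hclosed : IsClosed {h : Space d |
      0 ≤ ∑ i, h i * ∑ j, h j * (H x : Matrix (Fin d) (Fin d) ℝ) i j} :=
    isClosed_le continuous_const (by fun_prop)
  have hQ : ∀ h : Space d, 0 ≤ ∑ i, h i * ∑ j, h j * (H x : Matrix (Fin d) (Fin d) ℝ) i j := by
    intro h
    refine hclosed.closure_subset_iff.2 ?_ ((TopologicalSpace.denseRange_denseSeq (Space d)) h)
    rintro _ ⟨n, rfl⟩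
    exact hx n
  refine Matrix.PosSemidef.of_dotProduct_mulVec_nonneg ?_ fun v => ?_
  · rw [Matrix.IsHermitian, Matrix.conjTranspose_eq_transpose_of_trivial]
    exact (H x).2
  · refine (hQ (WithLp.toLp 2 v)).trans (le_of_eq ?_)
    simp only [dotProduct, Matrix.mulVec, star_trivial]
    exact Finset.sum_congr rfl fun i _ => by
      congr 1
      exact Finset.sum_congr rfl fun j _ => mul_comm _ _

end ConvexHessian

/-! ### Strong limits of Sobolev functions -/

section Limits

variable {d : ℕ} {p : ℝ}

theorem tendsto_eLpNorm_one {α : Type*} [MeasurableSpace α] {μ : Measure α} [IsFiniteMeasure μ]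
    {q : ℝ≥0∞} (hq : 1 ≤ q) {f : ℕ → α → ℝ} (hf : ∀ n, AEStronglyMeasurable (f n) μ)
    (h : Tendsto (fun n => eLpNorm (f n) q μ) atTop (𝓝 0)) :
    Tendsto (fun n => eLpNorm (f n) 1 μ) atTop (𝓝 0) := by
  set c := μ univ ^ (1 / (1 : ℝ≥0∞).toReal - 1 / q.toReal) with hc
  have hct : c ≠ ⊤ := by
    refine ENNReal.rpow_ne_top_of_nonneg ?_ (measure_ne_top μ _)
    by_cases hqt : q = ⊤
    · simp [hqt]
    · have : 1 ≤ q.toReal := by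
        simpa using ENNReal.toReal_mono hqt hq
      rw [ENNReal.toReal_one, div_one, sub_nonneg]
      exact (div_le_one (by linarith)).2 this
  have h1 : Tendsto (fun n => eLpNorm (f n) q μ * c) atTop (𝓝 0) := by
    simpa using ENNReal.Tendsto.mul_const h (Or.inr hct)
  exact tendsto_of_tendsto_of_tendsto_of_le_of_le tendsto_const_nhds h1 (fun _ => zero_le)
    fun n => eLpNorm_le_eLpNorm_mul_rpow_measure_univ hq (hf n)

theorem tendsto_integral_mul_of_tendsto_eLpNorm {α : Type*} [MeasurableSpace α] {μ : Measure α}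
    [IsFiniteMeasure μ] {q : ℝ≥0∞} (hq : 1 ≤ q) {f : ℕ → α → ℝ} {g φ : α → ℝ}
    (hf : ∀ n, MemLp (f n) q μ) (hg : MemLp g q μ) (hφ : AEStronglyMeasurable φ μ) {C : ℝ}
    (hC : ∀ x, ‖φ x‖ ≤ C)
    (h : Tendsto (fun n => eLpNorm (fun x => f n x - g x) q μ) atTop (𝓝 0)) :
    Tendsto (fun n => ∫ x, f n x * φ x ∂μ) atTop (𝓝 (∫ x, g x * φ x ∂μ)) := by
  have hm : ∀ n, AEStronglyMeasurable (fun x => f n x - g x) μ := fun n => (hf n).1.sub hg.1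
  have h1 := tendsto_eLpNorm_one hq hm h
  refine tendsto_integral_of_L1' _ (hg.1.mul hφ) (Eventually.of_forall fun n =>
    ((hf n).integrable hq).mul_bdd hφ (Eventually.of_forall hC)) ?_
  have h2 : Tendsto (fun n => ENNReal.ofReal C * eLpNorm (fun x => f n x - g x) 1 μ) atTop
      (𝓝 0) := by
    simpa using ENNReal.Tendsto.const_mul h1 (Or.inr ENNReal.ofReal_ne_top)
  refine tendsto_of_tendsto_of_tendsto_of_le_of_le tendsto_const_nhds h2 (fun _ => zero_le)
    fun n => ?_
  refine eLpNorm_le_mul_eLpNorm_of_ae_le_mul (Eventually.of_forall fun x => ?_) 1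
  simp only [Pi.sub_apply, Pi.mul_apply]
  rw [← sub_mul, norm_mul, mul_comm]
  gcongr
  exact hC x

theorem MemLpOn.locallyIntegrableOn (hp : 1 < p) {f : Space d → ℝ}
    (hf : MemLpOn p (unitBall d) f) : LocallyIntegrableOn f (unitBall d) :=
  (hf.integrableOn hp).locallyIntegrableOn

/-- Weak derivatives pass to strong limits. -/
theorem hasWeakPartial_of_tendsto (hp : 1 < p) {i : Fin d} {u v : ℕ → Space d → ℝ}
    {u' v' : Space d → ℝ} (huv : ∀ n, HasWeakPartial (unitBall d) i (u n) (v n))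
    (hu : ∀ n, MemLpOn p (unitBall d) (u n)) (hv : ∀ n, MemLpOn p (unitBall d) (v n))
    (hu' : MemLpOn p (unitBall d) u') (hv' : MemLpOn p (unitBall d) v')
    (htu : Tendsto (fun n => eLpNorm (fun x => u n x - u' x) (ENNReal.ofReal p)
      (volume.restrict (unitBall d))) atTop (𝓝 0))
    (htv : Tendsto (fun n => eLpNorm (fun x => v n x - v' x) (ENNReal.ofReal p)
      (volume.restrict (unitBall d))) atTop (𝓝 0)) :
    HasWeakPartial (unitBall d) i u' v' := by
  refine ⟨hu'.locallyIntegrableOn hp, hv'.locallyIntegrableOn hp, fun φ hφ => ?_⟩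
  have hq := ENNReal.one_le_ofReal.2 hp.le
  have hφ' : IsTestFunction (unitBall d) (partialDeriv i φ) := hφ.directionalDeriv _
  obtain ⟨C, hC⟩ := hφ.exists_bound
  obtain ⟨C', hC'⟩ := hφ'.exists_bound
  have h1 := tendsto_integral_mul_of_tendsto_eLpNorm hq hu hu'
    hφ'.1.continuous.aestronglyMeasurable hC' htu
  have h2 := tendsto_integral_mul_of_tendsto_eLpNorm hq hv hv'
    hφ.1.continuous.aestronglyMeasurable hC htv
  refine tendsto_nhds_unique h1 (h2.neg.congr fun n => ?_)
  rw [(huv n).2.2 φ hφ]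

theorem HasWeakPartial.congr {Ω : Set (Space d)} (hΩ : IsOpen Ω) {i : Fin d}
    {u u' v : Space d → ℝ} (h : HasWeakPartial Ω i u v) (huu' : u =ᵐ[volume.restrict Ω] u') :
    HasWeakPartial Ω i u' v := by
  refine ⟨fun x hx => ?_, h.2.1, fun φ hφ => ?_⟩
  · obtain ⟨s, hs, hi⟩ := h.1 x hx
    have hnhds : 𝓝[Ω] x = 𝓝 x := hΩ.nhdsWithin_eq hx
    refine ⟨s ∩ Ω, Filter.inter_mem hs self_mem_nhdsWithin, ?_⟩
    exact (hi.mono_set inter_subset_left).congr_fun_ae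
      (ae_restrict_of_ae_restrict_of_subset inter_subset_right huu')
  · rw [← h.2.2 φ hφ]
    exact integral_congr_ae (huu'.symm.mono fun x hx => by simp only [hx])

theorem HasWeakPartial.mono {Ω V : Set (Space d)} (hΩ : MeasurableSet Ω)
    (hVΩ : V ⊆ Ω) {i : Fin d} {u v : Space d → ℝ} (h : HasWeakPartial Ω i u v) :
    HasWeakPartial V i u v := by
  refine ⟨h.1.mono_set hVΩ, h.2.1.mono_set hVΩ, fun φ hφ => ?_⟩
  have hres : ∀ (f ψ : Space d → ℝ), IsTestFunction V ψ →
      ∫ x in V, f x * ψ x = ∫ x in Ω, f x * ψ x := fun f ψ hψ =>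
    (setIntegral_eq_of_subset_of_forall_sdiff_eq_zero hΩ hVΩ fun x hx => by
      rw [hψ.eq_zero hx.2, mul_zero]).symm
  rw [hres v φ hφ, hres u (partialDeriv i φ) (hφ.directionalDeriv _)]
  exact h.2.2 φ (hφ.mono hVΩ)

theorem MemLpOn.mono {Ω V : Set (Space d)} (hVΩ : V ⊆ Ω) {u : Space d → ℝ}
    (h : MemLpOn p Ω u) : MemLpOn p V u :=
  MemLp.mono_measure (Measure.restrict_mono_set volume hVΩ) h

theorem MemW2.memW2Loc {Ω : Set (Space d)} (hΩ : IsOpen Ω) {u : Space d → ℝ} (h : MemW2 p Ω u) :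
    MemW2Loc p Ω u := by
  obtain ⟨hu, G, H, hG, hH⟩ := h
  intro V hV _ hVΩ
  have hsub : V ⊆ Ω := subset_closure.trans hVΩ
  exact ⟨hu.mono hsub, G, H,
    fun i => ⟨(hG i).1.mono hΩ.measurableSet hsub, (hG i).2.mono hsub⟩,
    fun i j => ⟨(hH i j).1.mono hΩ.measurableSet hsub, (hH i j).2.mono hsub⟩⟩

theorem eLpNorm_sub_le_sub_add_sub {α : Type*} [MeasurableSpace α] {μ : Measure α} {q : ℝ≥0∞}
    (hq : 1 ≤ q) {f g h : α → ℝ} (hf : AEStronglyMeasurable f μ) (hg : AEStronglyMeasurable g μ)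
    (hh : AEStronglyMeasurable h μ) :
    eLpNorm (fun x => f x - h x) q μ ≤
      eLpNorm (fun x => f x - g x) q μ + eLpNorm (fun x => g x - h x) q μ := by
  have := eLpNorm_add_le (hf.sub hg) (hg.sub hh) hq
  refine le_trans (le_of_eq ?_) this
  congr 1
  ext x
  simp

/-- `W^{1,p}_0` is closed under strong limits. -/
theorem memW1Zero_of_tendsto (hp : 1 < p) {w : ℕ → Space d → ℝ} {w' : Space d → ℝ}
    {G : ℕ → Fin d → Space d → ℝ} {G' : Fin d → Space d → ℝ}
    (hw : ∀ n, MemW1Zero p (unitBall d) (w n))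
    (hG : ∀ n i, HasWeakPartial (unitBall d) i (w n) (G n i))
    (hw' : MemLpOn p (unitBall d) w')
    (hG' : ∀ i, HasWeakPartial (unitBall d) i w' (G' i) ∧ MemLpOn p (unitBall d) (G' i))
    (htw : Tendsto (fun n => eLpNorm (fun x => w n x - w' x) (ENNReal.ofReal p)
      (volume.restrict (unitBall d))) atTop (𝓝 0))
    (htG : ∀ i, Tendsto (fun n => eLpNorm (fun x => G n i x - G' i x) (ENNReal.ofReal p)
      (volume.restrict (unitBall d))) atTop (𝓝 0)) :
    MemW1Zero p (unitBall d) w' := by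
  have hq := ENNReal.one_le_ofReal.2 hp.le
  have hex : ∀ n : ℕ, ∃ φ : Space d → ℝ, IsTestFunction (unitBall d) φ ∧
      eLpNorm (fun x => φ x - w n x) (ENNReal.ofReal p) (volume.restrict (unitBall d)) ≤
        ENNReal.ofReal (1 / ((n : ℝ) + 1)) ∧
      ∀ i, eLpNorm (fun x => partialDeriv i φ x - G n i x) (ENNReal.ofReal p)
        (volume.restrict (unitBall d)) ≤ ENNReal.ofReal (1 / ((n : ℝ) + 1)) := by
    intro n
    -- the gradient `K` in the definition agrees almost everywhere with the given `G n`
    obtain ⟨-, K, hK, φ, hφ, hφw, hφK⟩ := hw n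
    have hpos : (0 : ℝ≥0∞) < ENNReal.ofReal (1 / ((n : ℝ) + 1)) :=
      ENNReal.ofReal_pos.2 (by positivity)
    have h1 := hφw.eventually (gt_mem_nhds hpos)
    have h2 : ∀ᶠ m in atTop, ∀ i, eLpNorm (fun x => partialDeriv i (φ m) x - K i x)
        (ENNReal.ofReal p) (volume.restrict (unitBall d)) < ENNReal.ofReal (1 / ((n : ℝ) + 1)) :=
      eventually_all.2 fun i => (hφK i).eventually (gt_mem_nhds hpos)
    obtain ⟨m, hm1, hm2⟩ := (h1.and h2).exists
    refine ⟨φ m, hφ m, hm1.le, fun i => ?_⟩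
    have hae := HasWeakPartial.ae_eq Metric.isOpen_ball (EventuallyEq.refl _ _) (hK i).1 (hG n i)
    exact (eLpNorm_congr_ae ((EventuallyEq.refl _ (partialDeriv i (φ m))).sub hae)).symm.trans_le
      (hm2 i).le
  choose φ hφ hφw hφG using hex
  have hzero : Tendsto (fun n : ℕ => ENNReal.ofReal (1 / ((n : ℝ) + 1))) atTop (𝓝 0) := by
    simpa using ENNReal.tendsto_ofReal (tendsto_one_div_add_atTop_nhds_zero_nat (𝕜 := ℝ))
  refine ⟨hw', G', hG', φ, hφ, ?_, fun i => ?_⟩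
  · refine tendsto_of_tendsto_of_tendsto_of_le_of_le tendsto_const_nhds
      (by simpa only [add_zero] using hzero.add htw) (fun _ => zero_le) fun n => ?_
    exact (eLpNorm_sub_le_sub_add_sub hq (hφ n).1.continuous.aestronglyMeasurable (hw n).1.1
      hw'.1).trans (add_le_add_left (hφw n) _)
  · refine tendsto_of_tendsto_of_tendsto_of_le_of_le tendsto_const_nhds
      (by simpa only [add_zero] using hzero.add (htG i)) (fun _ => zero_le) fun n => ?_
    have hGm : AEStronglyMeasurable (G n i) (volume.restrict (unitBall d)) :=
      (hG n i).2.1.aestronglyMeasurable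
    exact (eLpNorm_sub_le_sub_add_sub hq
      ((hφ n).directionalDeriv _).1.continuous.aestronglyMeasurable hGm
      (hG' i).2.1).trans (add_le_add_left (hφG n i) _)

theorem IsTestFunction.setIntegral_partialDeriv {φ : Space d → ℝ}
    (hφ : IsTestFunction (unitBall d) φ) (i : Fin d) :
    ∫ x in unitBall d, partialDeriv i φ x = 0 := by
  have hψ := hφ.directionalDeriv (EuclideanSpace.single i 1)
  have h1 : Integrable (partialDeriv i φ) :=
    hψ.1.continuous.integrable_of_hasCompactSupport hψ.2.1
  have h2 : Integrable φ := hφ.1.continuous.integrable_of_hasCompactSupport hφ.2.1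
  have h3 := integral_mul_fderiv_eq_neg_fderiv_mul_of_integrable (μ := volume)
    (f := fun _ : Space d => (1 : ℝ)) (g := φ) (v := EuclideanSpace.single i 1)
    (by simp) (by simp only [one_mul]; exact h1) (by simpa only [one_mul] using h2)
    (fun x _ => differentiableAt_const _)
    (fun x _ => (hφ.1.differentiable (by simp)).differentiableAt)
  simp only [one_mul, fderiv_fun_const, Pi.zero_apply, _root_.zero_apply, zero_mul,
    integral_zero, neg_zero] at h3
  rw [setIntegral_eq_integral_of_forall_compl_eq_zero]
  · exact h3
  · exact fun x hx => hψ.eq_zero hx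

/-- On `W^{2,p} ∩ W^{1,p}_0` the full norm is controlled by the second derivatives: the first
derivatives of such a function have mean zero. -/
theorem exists_sobolev_bound (hd : 1 ≤ d) (hp : 1 < p) : ∃ C : ℝ≥0∞, C ≠ ⊤ ∧
    ∀ (w : Space d → ℝ) (G : Fin d → Space d → ℝ) (H : Fin d → Fin d → Space d → ℝ),
      MemW1Zero p (unitBall d) w →
      (∀ i, HasWeakPartial (unitBall d) i w (G i) ∧ MemLpOn p (unitBall d) (G i)) →
      (∀ i j, HasWeakPartial (unitBall d) j (G i) (H i j) ∧ MemLpOn p (unitBall d) (H i j)) →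
      eLpNorm w (ENNReal.ofReal p) (volume.restrict (unitBall d)) ≤ C * ∑ i, ∑ j,
        eLpNorm (H i j) (ENNReal.ofReal p) (volume.restrict (unitBall d)) ∧
      ∀ i, eLpNorm (G i) (ENNReal.ofReal p) (volume.restrict (unitBall d)) ≤ C * ∑ i, ∑ j,
        eLpNorm (H i j) (ENNReal.ofReal p) (volume.restrict (unitBall d)) := by
  obtain ⟨C, hCt, hC⟩ := exists_poincare_mean_zero d hp
  refine ⟨2 * C, ENNReal.mul_ne_top (by simp) hCt, ?_⟩
  intro w G H hw hG hH
  have hq := ENNReal.one_le_ofReal.2 hp.le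
  obtain ⟨hwp, K, hK, φ, hφ, hφw, hφK⟩ := hw
  have hKG : ∀ i, K i =ᵐ[volume.restrict (unitBall d)] G i := fun i =>
    HasWeakPartial.ae_eq Metric.isOpen_ball (EventuallyEq.refl _ _) (hK i).1 (hG i).1
  have hφG : ∀ i, Tendsto (fun n => eLpNorm (fun x => partialDeriv i (φ n) x - G i x)
      (ENNReal.ofReal p) (volume.restrict (unitBall d))) atTop (𝓝 0) := fun i =>
    (hφK i).congr fun n => eLpNorm_congr_ae
      ((EventuallyEq.refl _ (partialDeriv i (φ n))).sub (hKG i))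
  have hpdLp : ∀ n i, MemLp (partialDeriv i (φ n)) (ENNReal.ofReal p)
      (volume.restrict (unitBall d)) := fun n i => by
    have hψ := (hφ n).directionalDeriv (EuclideanSpace.single i 1)
    exact (hψ.1.continuous.memLp_of_hasCompactSupport hψ.2.1).restrict _
  have hmean : ∀ i, ∫ x in unitBall d, G i x = 0 := fun i => by
    have h1 := tendsto_integral_mul_of_tendsto_eLpNorm hq (fun n => hpdLp n i) (hG i).2
      (φ := fun _ => (1 : ℝ)) aestronglyMeasurable_const (C := 1) (by simp) (hφG i)
    simp only [mul_one, (hφ _).setIntegral_partialDeriv] at h1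
    exact tendsto_nhds_unique h1 tendsto_const_nhds
  have hGle : ∀ i, eLpNorm (G i) (ENNReal.ofReal p) (volume.restrict (unitBall d)) ≤
      C * ∑ i, ∑ j, eLpNorm (H i j) (ENNReal.ofReal p) (volume.restrict (unitBall d)) := by
    intro i
    refine (hC (G i) (H i) (hG i).2 (hH i) (hmean i)).trans ?_
    refine mul_le_mul_right ?_ C
    exact Finset.single_le_sum (f := fun i => ∑ j, eLpNorm (H i j) (ENNReal.ofReal p)
      (volume.restrict (unitBall d))) (fun _ _ => zero_le) (Finset.mem_univ i)
  have hwle : eLpNorm w (ENNReal.ofReal p) (volume.restrict (unitBall d)) ≤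
      2 * eLpNorm (G ⟨0, hd⟩) (ENNReal.ofReal p) (volume.restrict (unitBall d)) := by
    set i : Fin d := ⟨0, hd⟩
    have hlim : Tendsto (fun n => eLpNorm (fun x => φ n x - w x) (ENNReal.ofReal p)
        (volume.restrict (unitBall d)) + 2 * (eLpNorm (fun x => partialDeriv i (φ n) x - G i x)
          (ENNReal.ofReal p) (volume.restrict (unitBall d)) +
          eLpNorm (G i) (ENNReal.ofReal p) (volume.restrict (unitBall d)))) atTop
        (𝓝 (0 + 2 * (0 + eLpNorm (G i) (ENNReal.ofReal p) (volume.restrict (unitBall d))))) :=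
      hφw.add (ENNReal.Tendsto.const_mul ((hφG i).add tendsto_const_nhds) (Or.inr (by simp)))
    rw [zero_add, zero_add] at hlim
    refine ge_of_tendsto hlim (Eventually.of_forall fun n => ?_)
    have hφm : AEStronglyMeasurable (φ n) (volume.restrict (unitBall d)) :=
      (hφ n).1.continuous.aestronglyMeasurable
    have h1 : eLpNorm w (ENNReal.ofReal p) (volume.restrict (unitBall d)) ≤
        eLpNorm (fun x => φ n x - w x) (ENNReal.ofReal p) (volume.restrict (unitBall d)) +
        eLpNorm (φ n) (ENNReal.ofReal p) (volume.restrict (unitBall d)) := by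
      have := eLpNorm_sub_le hφm (hφm.sub hwp.1) hq
      rw [sub_sub_cancel] at this
      rw [add_comm]
      exact this
    have h2 : eLpNorm (partialDeriv i (φ n)) (ENNReal.ofReal p) (volume.restrict (unitBall d)) ≤
        eLpNorm (fun x => partialDeriv i (φ n) x - G i x) (ENNReal.ofReal p)
          (volume.restrict (unitBall d)) +
        eLpNorm (G i) (ENNReal.ofReal p) (volume.restrict (unitBall d)) := by
      have := eLpNorm_add_le ((hpdLp n i).1.sub (hG i).2.1) (hG i).2.1 hq
      rw [sub_add_cancel] at this
      exact this
    calc _ ≤ _ := h1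
      _ ≤ _ := add_le_add_right (((hφ n).eLpNorm_le hp i).trans (mul_le_mul_right h2 2)) _
  refine ⟨hwle.trans ?_, fun i => (hGle i).trans ?_⟩
  · rw [mul_assoc]
    gcongr
    exact hGle _
  · gcongr
    exact le_mul_of_one_le_left zero_le (by norm_num)

end Limits

/-! ### Limits of convex functions -/

section ConvexLimits

variable {d : ℕ} {Ω : Set (Space d)}

theorem ae_reflection {P : Space d → Prop} (hP : ∀ᵐ z, P z) (x : Space d) :
    ∀ᵐ z, P ((2 : ℝ) • x - z) :=
  (Measure.measurePreserving_sub_left volume ((2 : ℝ) • x)).quasiMeasurePreserving.ae hP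

theorem ae_midpoint {P : Space d → Prop} (hP : ∀ᵐ z, P z) (x : Space d) :
    ∀ᵐ z, P ((1 / 2 : ℝ) • x + (1 / 2 : ℝ) • z) := by
  have h1 : ∀ᵐ z, P ((1 / 2 : ℝ) • x + z) :=
    (measurePreserving_add_left volume ((1 / 2 : ℝ) • x)).quasiMeasurePreserving.ae hP
  have h2 : Measure.QuasiMeasurePreserving (fun z : Space d => (1 / 2 : ℝ) • z) := by
    refine ⟨measurable_const_smul _, ?_⟩
    rw [Measure.map_addHaar_smul volume (by norm_num)]
    exact Measure.smul_absolutelyContinuous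
  exact h2.ae h1

/-- Convex functions that converge almost everywhere are bounded at every point of an open set:
above by averaging two opposite points at which they converge, below by writing such a point as
the midpoint of `x` and another one. -/
theorem exists_bound_of_convexOn (hΩ : IsOpen Ω) {v : ℕ → Space d → ℝ}
    (hv : ∀ n, ConvexOn ℝ Ω (v n)) {u : Space d → ℝ}
    (hlim : ∀ᵐ x, x ∈ Ω → Tendsto (fun n => v n x) atTop (𝓝 (u x))) {x : Space d} (hx : x ∈ Ω) :
    ∃ M : ℝ, ∀ n, v n x ∈ Icc (-M) M := by
  obtain ⟨ε, hε, hball⟩ := Metric.isOpen_iff.1 hΩ x hx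
  have hpos : volume (Metric.ball x ε) ≠ 0 := (Metric.measure_ball_pos volume x hε).ne'
  obtain ⟨z, hz, h1, h2, h3⟩ : ∃ z ∈ Metric.ball x ε,
      (z ∈ Ω → Tendsto (fun n => v n z) atTop (𝓝 (u z))) ∧
      ((2 : ℝ) • x - z ∈ Ω → Tendsto (fun n => v n ((2 : ℝ) • x - z)) atTop
        (𝓝 (u ((2 : ℝ) • x - z)))) ∧
      ((1 / 2 : ℝ) • x + (1 / 2 : ℝ) • z ∈ Ω →
        Tendsto (fun n => v n ((1 / 2 : ℝ) • x + (1 / 2 : ℝ) • z)) atTop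
          (𝓝 (u ((1 / 2 : ℝ) • x + (1 / 2 : ℝ) • z)))) := by
    by_contra hcon
    push Not at hcon
    refine hpos (measure_mono_null (fun z hz => ?_) (ae_iff.1
      ((hlim.and (ae_reflection hlim x)).and (ae_midpoint hlim x))))
    intro hall
    obtain ⟨hm, hnt⟩ := hcon z hz hall.1.1 hall.1.2
    exact hnt (hall.2 hm)
  have hbdd : ∀ y, Tendsto (fun n => v n y) atTop (𝓝 (u y)) → ∃ M, ∀ n, |v n y| ≤ M := by
    intro y hy
    obtain ⟨M, hM⟩ := (Metric.isBounded_range_of_tendsto _ hy).exists_norm_le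
    exact ⟨M, fun n => hM _ (mem_range_self n)⟩
  have hzΩ := hball hz
  have hrΩ : (2 : ℝ) • x - z ∈ Ω := hball (by
    rw [Metric.mem_ball, dist_eq_norm] at hz ⊢
    rw [show (2 : ℝ) • x - z - x = -(z - x) by module, norm_neg]
    exact hz)
  have hmΩ : (1 / 2 : ℝ) • x + (1 / 2 : ℝ) • z ∈ Ω :=
    (hv 0).1 hx hzΩ (by norm_num) (by norm_num) (by norm_num)
  obtain ⟨M1, hM1⟩ := hbdd z (h1 hzΩ)
  obtain ⟨M2, hM2⟩ := hbdd _ (h2 hrΩ)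
  obtain ⟨M3, hM3⟩ := hbdd _ (h3 hmΩ)
  refine ⟨2 * M3 + M1 + M2, fun n => ?_⟩
  have hup := (hv n).2 hzΩ hrΩ (show (0 : ℝ) ≤ 1 / 2 by norm_num)
    (show (0 : ℝ) ≤ 1 / 2 by norm_num) (by norm_num)
  have hlow := (hv n).2 hx hzΩ (show (0 : ℝ) ≤ 1 / 2 by norm_num)
    (show (0 : ℝ) ≤ 1 / 2 by norm_num) (by norm_num)
  rw [show (1 / 2 : ℝ) • z + (1 / 2 : ℝ) • ((2 : ℝ) • x - z) = x by module] at hup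
  simp only [smul_eq_mul] at hup hlow
  have b1 := abs_le.1 (hM1 n)
  have b2 := abs_le.1 (hM2 n)
  have b3 := abs_le.1 (hM3 n)
  exact ⟨by linarith, by linarith⟩

/-- An almost everywhere limit of convex functions has a convex representative: the pointwise limit
along an ultrafilter. -/
theorem exists_convexOn_ae_eq (hΩ : IsOpen Ω) {v : ℕ → Space d → ℝ}
    (hv : ∀ n, ConvexOn ℝ Ω (v n)) {u : Space d → ℝ}
    (hlim : ∀ᵐ x ∂(volume.restrict Ω), Tendsto (fun n => v n x) atTop (𝓝 (u x))) :
    ∃ u', ConvexOn ℝ Ω u' ∧ u =ᵐ[volume.restrict Ω] u' := by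
  rw [ae_restrict_iff' hΩ.measurableSet] at hlim
  have hex : ∀ x, ∃ l : ℝ, x ∈ Ω →
      Tendsto (fun n => v n x) (hyperfilter ℕ : Filter ℕ) (𝓝 l) := by
    intro x
    by_cases hx : x ∈ Ω
    · obtain ⟨M, hM⟩ := exists_bound_of_convexOn hΩ hv hlim hx
      obtain ⟨l, -, hl⟩ := (isCompact_Icc (a := -M) (b := M)).ultrafilter_le_nhds
        ((hyperfilter ℕ).map fun n => v n x) (by
          rw [le_principal_iff]
          exact Ultrafilter.mem_map.2 (Eventually.of_forall hM))
      exact ⟨l, fun _ => hl⟩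
    · exact ⟨0, fun h => absurd h hx⟩
  choose u' hu' using hex
  refine ⟨u', ⟨(hv 0).1, fun x hx y hy a b ha hb hab => ?_⟩, ?_⟩
  · refine le_of_tendsto_of_tendsto (hu' _ ((hv 0).1 hx hy ha hb hab))
      (((hu' x hx).const_smul a).add ((hu' y hy).const_smul b)) ?_
    exact Eventually.of_forall fun n => (hv n).2 hx hy ha hb hab
  · refine (ae_restrict_iff' hΩ.measurableSet).2 ?_
    filter_upwards [hlim] with x hx hxΩ
    exact tendsto_nhds_unique ((hx hxΩ).mono_left Nat.hyperfilter_le_atTop) (hu' x hxΩ)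

end ConvexLimits

/-! ### Uniformly elliptic operators -/

section Elliptic

variable {d : ℕ} {lam Lam : ℝ} {F : SymMat d → ℝ}

/-- The sum of the absolute values of the entries. -/
def entrySum (M : SymMat d) : ℝ := ∑ i, ∑ j, |(M : Matrix (Fin d) (Fin d) ℝ) i j|

theorem entrySum_nonneg (M : SymMat d) : 0 ≤ entrySum M :=
  Finset.sum_nonneg fun _ _ => Finset.sum_nonneg fun _ _ => abs_nonneg _

theorem exists_specNorm_le (d : ℕ) :
    ∃ K : ℝ, 0 ≤ K ∧ ∀ M : SymMat d, specNorm M ≤ K * entrySum M := by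
  let e : Fin d → Fin d → ℝ := fun i j =>
    ‖Matrix.toEuclideanCLM (𝕜 := ℝ) (Matrix.single i j (1 : ℝ))‖
  have he : ∀ i j, e i j ≤ ∑ i, ∑ j, e i j := fun i j =>
    (Finset.single_le_sum (f := fun j => e i j) (fun _ _ => norm_nonneg _)
      (Finset.mem_univ j)).trans (Finset.single_le_sum (f := fun i => ∑ j, e i j)
        (fun _ _ => Finset.sum_nonneg fun _ _ => norm_nonneg _) (Finset.mem_univ i))
  refine ⟨∑ i, ∑ j, e i j, Finset.sum_nonneg fun _ _ => Finset.sum_nonneg fun _ _ => norm_nonneg _,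
    fun M => ?_⟩
  set A := (M : Matrix (Fin d) (Fin d) ℝ) with hA
  have h1 : A = ∑ i, ∑ j, A i j • Matrix.single i j (1 : ℝ) := by
    conv_lhs => rw [Matrix.matrix_eq_sum_single A]
    simp [Matrix.smul_single]
  have h2 : specNorm M ≤ ∑ i, ∑ j, |A i j| * e i j := by
    unfold specNorm
    rw [← hA]
    conv_lhs => rw [h1]
    simp only [map_sum, map_smul]
    refine (norm_sum_le _ _).trans (Finset.sum_le_sum fun i _ => ?_)
    refine (norm_sum_le _ _).trans (Finset.sum_le_sum fun j _ => ?_)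
    rw [norm_smul, Real.norm_eq_abs]
  refine h2.trans ?_
  rw [entrySum, Finset.mul_sum]
  refine Finset.sum_le_sum fun i _ => ?_
  rw [Finset.mul_sum]
  refine Finset.sum_le_sum fun j _ => ?_
  rw [mul_comm]
  exact mul_le_mul_of_nonneg_right (he i j) (abs_nonneg _)

theorem abs_apply_le_specNorm (M : SymMat d) (i j : Fin d) :
    |(M : Matrix (Fin d) (Fin d) ℝ) i j| ≤ specNorm M := by
  have h1 : (Matrix.toEuclideanCLM (𝕜 := ℝ) (M : Matrix (Fin d) (Fin d) ℝ)
      (EuclideanSpace.single j 1)) i = (M : Matrix (Fin d) (Fin d) ℝ) i j := by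
    rw [Matrix.ofLp_toEuclideanCLM]
    simp
  rw [← h1, ← Real.norm_eq_abs]
  refine (PiLp.norm_apply_le _ i).trans ?_
  refine (ContinuousLinearMap.le_opNorm _ _).trans (le_of_eq ?_)
  simp [specNorm]

/-- The sum of the absolute values of the entries dominates the quadratic form on unit vectors. -/
theorem posSemidef_add_smul_one (M : SymMat d) :
    ((M : Matrix (Fin d) (Fin d) ℝ) + entrySum M • (1 : Matrix (Fin d) (Fin d) ℝ)).PosSemidef := by
  refine Matrix.PosSemidef.of_dotProduct_mulVec_nonneg ?_ fun v => ?_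
  · have hM : (M : Matrix (Fin d) (Fin d) ℝ).transpose = M := M.2
    rw [Matrix.IsHermitian, Matrix.conjTranspose_eq_transpose_of_trivial]
    simp [hM]
  · set A := (M : Matrix (Fin d) (Fin d) ℝ) with hA
    set S := ∑ k, v k ^ 2 with hS
    have hk : ∀ k, v k ^ 2 ≤ S := fun k =>
      Finset.single_le_sum (f := fun k => v k ^ 2) (fun _ _ => sq_nonneg _) (Finset.mem_univ k)
    have h1 : star v ⬝ᵥ ((A + entrySum M • (1 : Matrix (Fin d) (Fin d) ℝ)).mulVec v) =
        (∑ i, ∑ j, A i j * (v i * v j)) + entrySum M * S := by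
      rw [Matrix.add_mulVec, Matrix.smul_mulVec, Matrix.one_mulVec, dotProduct_add,
        dotProduct_smul]
      simp only [dotProduct, Matrix.mulVec, star_trivial, smul_eq_mul, hS]
      congr 1
      · refine Finset.sum_congr rfl fun i _ => ?_
        rw [Finset.mul_sum]
        exact Finset.sum_congr rfl fun j _ => by ring
      · congr 1
        exact Finset.sum_congr rfl fun j _ => by ring
    have h2 : -(entrySum M * S) ≤ ∑ i, ∑ j, A i j * (v i * v j) := by
      rw [entrySum, Finset.sum_mul, ← Finset.sum_neg_distrib]
      refine Finset.sum_le_sum fun i _ => ?_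
      rw [Finset.sum_mul, ← Finset.sum_neg_distrib]
      refine Finset.sum_le_sum fun j _ => ?_
      have h3 : |v i * v j| ≤ S := by
        rw [abs_le]
        constructor <;> nlinarith [hk i, hk j, sq_nonneg (v i + v j), sq_nonneg (v i - v j)]
      have h4 : |A i j * (v i * v j)| ≤ |A i j| * S := by
        rw [abs_mul]
        exact mul_le_mul_of_nonneg_left h3 (abs_nonneg _)
      linarith [neg_abs_le (A i j * (v i * v j))]
    rw [h1]
    linarith

/-- A uniformly elliptic operator is Lipschitz: a symmetric matrix becomes positive semidefinite
after adding a multiple of the identity comparable to its norm. -/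
theorem UniformlyElliptic.exists_lipschitz (hF : UniformlyElliptic lam Lam F) :
    ∃ L : ℝ, 0 ≤ L ∧ ∀ M N : SymMat d, |F M - F N| ≤ L * entrySum (M - N) := by
  obtain ⟨K, hK0, hK⟩ := exists_specNorm_le d
  have hLam : 0 < Lam := hF.pos.trans_le hF.le
  let one : SymMat d := ⟨1, Matrix.isSymm_one⟩
  have hone : 0 ≤ entrySum one := entrySum_nonneg _
  have hsmul : ∀ (c : ℝ) (M : SymMat d), 0 ≤ c → entrySum (c • M) = c * entrySum M := by
    intro c M hc
    simp only [entrySum, Finset.mul_sum]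
    refine Finset.sum_congr rfl fun i _ => Finset.sum_congr rfl fun j _ => ?_
    simp [abs_mul, abs_of_nonneg hc]
  have hadd : ∀ M N : SymMat d, entrySum (M + N) ≤ entrySum M + entrySum N := by
    intro M N
    simp only [entrySum, ← Finset.sum_add_distrib]
    exact Finset.sum_le_sum fun i _ => Finset.sum_le_sum fun j _ => abs_add_le _ _
  have hneg : ∀ M : SymMat d, entrySum (-M) = entrySum M := by
    intro M
    simp [entrySum]
  have key : ∀ M N : SymMat d, F M - F N ≤ Lam * (K * (1 + entrySum one)) * entrySum (M - N) := by
    intro M N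
    set c := entrySum (M - N) with hc
    have hc0 : 0 ≤ c := entrySum_nonneg _
    have hQ : ((c • one : SymMat d) : Matrix (Fin d) (Fin d) ℝ).PosSemidef :=
      Matrix.PosSemidef.one.smul hc0
    have h1 := hF.lower M (c • one) hQ
    have h2 := hF.upper N (M - N + c • one) (posSemidef_add_smul_one (M - N))
    have h3 : N + (M - N + c • one) = M + c • one := by abel
    rw [h3] at h2
    have h4 : 0 ≤ lam * specNorm (c • one) := mul_nonneg hF.pos.le (norm_nonneg _)
    have h5 : specNorm (M - N + c • one) ≤ K * (1 + entrySum one) * c := by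
      refine (hK _).trans ?_
      rw [mul_assoc]
      refine mul_le_mul_of_nonneg_left ?_ hK0
      refine (hadd _ _).trans ?_
      rw [hsmul c one hc0]
      linarith
    calc F M - F N ≤ Lam * specNorm (M - N + c • one) := by linarith
      _ ≤ Lam * (K * (1 + entrySum one) * c) := mul_le_mul_of_nonneg_left h5 hLam.le
      _ = _ := by ring
  refine ⟨Lam * (K * (1 + entrySum one)), by positivity, fun M N => ?_⟩
  rw [abs_le]
  refine ⟨?_, key M N⟩
  have := key N M
  rw [← neg_sub M N, hneg] at this
  linarith

/-- The symmetric part `(A + Aᵀ) / 2` of a matrix. -/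
noncomputable def symmPart (A : Fin d → Fin d → ℝ) : SymMat d :=
  ⟨Matrix.of fun i j => (A i j + A j i) / 2, by
    refine Matrix.ext fun i j => ?_
    simp only [Matrix.transpose_apply, Matrix.of_apply]
    ring⟩

theorem symmPart_apply (A : Fin d → Fin d → ℝ) (i j : Fin d) :
    (symmPart A : Matrix (Fin d) (Fin d) ℝ) i j = (A i j + A j i) / 2 := rfl

theorem symMat_apply_comm (M : SymMat d) (i j : Fin d) :
    (M : Matrix (Fin d) (Fin d) ℝ) i j = (M : Matrix (Fin d) (Fin d) ℝ) j i :=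
  M.2.apply j i

theorem symmPart_coe (M : SymMat d) :
    symmPart (fun i j => (M : Matrix (Fin d) (Fin d) ℝ) i j) = M := by
  refine Subtype.ext (Matrix.ext fun i j => ?_)
  rw [symmPart_apply, ← symMat_apply_comm M i j]
  ring

/-- Composition with `F` preserves measurability: `F (H x)` is a continuous function of the entries
of `H x`, through the symmetric part. -/
theorem UniformlyElliptic.aestronglyMeasurable_comp (hF : UniformlyElliptic lam Lam F)
    {α : Type*} [MeasurableSpace α] {μ : Measure α} {H : α → SymMat d}
    (hH : ∀ i j, AEStronglyMeasurable (fun x => (H x : Matrix (Fin d) (Fin d) ℝ) i j) μ) :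
    AEStronglyMeasurable (fun x => F (H x)) μ := by
  obtain ⟨L, hL0, hL⟩ := hF.exists_lipschitz
  have hcont : Continuous fun A : Fin d → Fin d → ℝ => F (symmPart A) := by
    refine continuous_iff_continuousAt.2 fun A => ?_
    have h0 : Tendsto (fun B : Fin d → Fin d → ℝ => L * ∑ i, ∑ j,
        |(B i j + B j i) / 2 - (A i j + A j i) / 2|) (𝓝 A) (𝓝 0) := by
      have hc : Continuous fun B : Fin d → Fin d → ℝ => L * ∑ i, ∑ j,
        |(B i j + B j i) / 2 - (A i j + A j i) / 2| := by fun_prop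
      simpa using hc.tendsto A
    refine tendsto_iff_norm_sub_tendsto_zero.2 (squeeze_zero (fun _ => norm_nonneg _) ?_ h0)
    exact fun B => hL _ _
  have hHm : AEStronglyMeasurable
      (fun x => fun i j => (H x : Matrix (Fin d) (Fin d) ℝ) i j) μ := by
    refine (aemeasurable_pi_lambda _ fun i =>
      aemeasurable_pi_lambda _ fun j => ?_).aestronglyMeasurable
    exact (hH i j).aemeasurable
  have := hcont.comp_aestronglyMeasurable hHm
  simpa only [symmPart_coe] using this

theorem UniformlyElliptic.le_of_posSemidef (hF : UniformlyElliptic lam Lam F) {M : SymMat d}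
    (hM : (M : Matrix (Fin d) (Fin d) ℝ).PosSemidef) : lam * specNorm M ≤ F M := by
  have := hF.lower 0 M hM
  rwa [zero_add, hF.map_zero, sub_zero] at this

theorem UniformlyElliptic.nonneg_of_posSemidef (hF : UniformlyElliptic lam Lam F) {M : SymMat d}
    (hM : (M : Matrix (Fin d) (Fin d) ℝ).PosSemidef) : 0 ≤ F M :=
  (mul_nonneg hF.pos.le (norm_nonneg _)).trans (hF.le_of_posSemidef hM)

end Elliptic

/-! ### Jets of Sobolev functions -/

section Jets

variable {d : ℕ} {p : ℝ}

theorem HasWeakPartial.linearCombination {Ω : Set (Space d)} {i : Fin d} {u u' v v' : Space d → ℝ}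
    (a b : ℝ) (h : HasWeakPartial Ω i u v) (h' : HasWeakPartial Ω i u' v') :
    HasWeakPartial Ω i (fun x => a * u x + b * u' x) (fun x => a * v x + b * v' x) := by
  have hmul : ∀ (c : ℝ) (f : Space d → ℝ), LocallyIntegrableOn f Ω →
      LocallyIntegrableOn (fun x => c * f x) Ω := fun c f hf x hx => by
    obtain ⟨s, hs, hi⟩ := hf x hx
    exact ⟨s, hs, hi.const_mul c⟩
  refine ⟨(hmul a _ h.1).add (hmul b _ h'.1), (hmul a _ h.2.1).add (hmul b _ h'.2.1),
    fun φ hφ => ?_⟩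
  have hlin : ∀ (f f' ψ : Space d → ℝ), LocallyIntegrableOn f Ω → LocallyIntegrableOn f' Ω →
      IsTestFunction Ω ψ → ∫ x in Ω, (a * f x + b * f' x) * ψ x =
        a * (∫ x in Ω, f x * ψ x) + b * ∫ x in Ω, f' x * ψ x := by
    intro f f' ψ hf hf' hψ
    rw [← integral_const_mul, ← integral_const_mul,
      ← integral_add ((hψ.integrableOn_mul hf).const_mul a) ((hψ.integrableOn_mul hf').const_mul b)]
    exact integral_congr_ae (Eventually.of_forall fun x => by simp only; ring)
  have hψ : IsTestFunction Ω (partialDeriv i φ) := hφ.directionalDeriv _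
  beta_reduce
  rw [hlin u u' _ h.1 h'.1 hψ, hlin v v' _ h.2.1 h'.2.1 hφ, h.2.2 φ hφ, h'.2.2 φ hφ]
  ring

theorem memLp_linearCombination {α : Type*} [MeasurableSpace α] {μ : Measure α} {q : ℝ≥0∞}
    {f g : α → ℝ} (a b : ℝ) (hf : MemLp f q μ) (hg : MemLp g q μ) :
    MemLp (fun x => a * f x + b * g x) q μ :=
  (hf.const_mul a).add (hg.const_mul b)

/-- A function `u ∈ W^{2,p}(B_1)` together with its weak gradient `G` and weak Hessian `H`. -/
structure IsW2Jet (p : ℝ) (u : Space d → ℝ) (G : Fin d → Space d → ℝ) (H : Space d → SymMat d) :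
    Prop where
  memLp : MemLpOn p (unitBall d) u
  grad : ∀ i, HasWeakPartial (unitBall d) i u (G i) ∧ MemLpOn p (unitBall d) (G i)
  hess : ∀ i j, HasWeakPartial (unitBall d) j (G i)
      (fun x => (H x : Matrix (Fin d) (Fin d) ℝ) i j) ∧
    MemLpOn p (unitBall d) (fun x => (H x : Matrix (Fin d) (Fin d) ℝ) i j)

theorem memW2_iff_exists_jet {u : Space d → ℝ} :
    MemW2 p (unitBall d) u ↔ ∃ G H, IsW2Jet p u G H :=
  ⟨fun ⟨hu, G, H, hG, hH⟩ => ⟨G, H, hu, hG, hH⟩, fun ⟨G, H, h⟩ => ⟨h.memLp, G, H, h.grad, h.hess⟩⟩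

theorem IsW2Jet.linearCombination {u u' : Space d → ℝ} {G G' : Fin d → Space d → ℝ}
    {H H' : Space d → SymMat d} (a b : ℝ) (h : IsW2Jet p u G H) (h' : IsW2Jet p u' G' H') :
    IsW2Jet p (fun x => a * u x + b * u' x) (fun i x => a * G i x + b * G' i x)
      (fun x => a • H x + b • H' x) where
  memLp := memLp_linearCombination a b h.memLp h'.memLp
  grad i := ⟨(h.grad i).1.linearCombination a b (h'.grad i).1,
    memLp_linearCombination a b (h.grad i).2 (h'.grad i).2⟩
  hess i j := ⟨(h.hess i j).1.linearCombination a b (h'.hess i j).1,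
    memLp_linearCombination a b (h.hess i j).2 (h'.hess i j).2⟩

theorem IsW2Jet.isWeakHessian {u : Space d → ℝ} {G : Fin d → Space d → ℝ}
    {H : Space d → SymMat d} (h : IsW2Jet p u G H) : IsWeakHessian (unitBall d) u H :=
  ⟨G, fun i => (h.grad i).1, fun i j => (h.hess i j).1⟩

theorem IsW2Jet.weakHessian_ae_eq {u : Space d → ℝ} {G : Fin d → Space d → ℝ}
    {H : Space d → SymMat d} (h : IsW2Jet p u G H) :
    weakHessian (unitBall d) u =ᵐ[volume.restrict (unitBall d)] H :=
  IsWeakHessian.ae_eq Metric.isOpen_ball (EventuallyEq.refl _ _)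
    (isWeakHessian_weakHessian h.isWeakHessian) h.isWeakHessian

theorem IsW2Jet.ae_posSemidef (hp : 1 < p) {u : Space d → ℝ} {G : Fin d → Space d → ℝ}
    {H : Space d → SymMat d} (h : IsW2Jet p u G H) (hu : ConvexOn ℝ (unitBall d) u) :
    ∀ᵐ x ∂(volume.restrict (unitBall d)), (H x : Matrix (Fin d) (Fin d) ℝ).PosSemidef :=
  ae_posSemidef_of_convexOn Metric.isOpen_ball hu (fun i => (h.grad i).1)
    (fun i j => (h.hess i j).1) (h.memLp.integrableOn hp) (fun i => (h.grad i).2.integrableOn hp)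
    (fun i j => (h.hess i j).2.integrableOn hp)

theorem eLpNorm_linearCombination_le {α : Type*} [MeasurableSpace α] {μ : Measure α} {q : ℝ≥0∞}
    (hq : 1 ≤ q) {f g : α → ℝ} (a b : ℝ) (hf : AEStronglyMeasurable f μ)
    (hg : AEStronglyMeasurable g μ) :
    eLpNorm (fun x => a * f x + b * g x) q μ ≤
      ENNReal.ofReal |a| * eLpNorm f q μ + ENNReal.ofReal |b| * eLpNorm g q μ := by
  have h1 := eLpNorm_add_le (hf.const_mul a) (hg.const_mul b) hq
  have h2 := eLpNorm_const_smul a f q μ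
  have h3 := eLpNorm_const_smul b g q μ
  rw [Real.enorm_eq_ofReal_abs] at h2 h3
  rw [← h2, ← h3]
  exact h1

theorem memW1Zero_midpoint (hp : 1 < p) {w w' : Space d → ℝ} (h : MemW1Zero p (unitBall d) w)
    (h' : MemW1Zero p (unitBall d) w') :
    MemW1Zero p (unitBall d) (fun x => 1 / 2 * w x + 1 / 2 * w' x) := by
  have hq := ENNReal.one_le_ofReal.2 hp.le
  obtain ⟨hw, G, hG, φ, hφ, hφw, hφG⟩ := h
  obtain ⟨hw', G', hG', φ', hφ', hφw', hφG'⟩ := h'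
  have hlim : ∀ {f f' : Space d → ℝ} {ψ ψ' : ℕ → Space d → ℝ},
      (∀ n, Continuous (ψ n)) → (∀ n, Continuous (ψ' n)) →
      AEStronglyMeasurable f (volume.restrict (unitBall d)) →
      AEStronglyMeasurable f' (volume.restrict (unitBall d)) →
      Tendsto (fun n => eLpNorm (fun x => ψ n x - f x) (ENNReal.ofReal p)
        (volume.restrict (unitBall d))) atTop (𝓝 0) →
      Tendsto (fun n => eLpNorm (fun x => ψ' n x - f' x) (ENNReal.ofReal p)
        (volume.restrict (unitBall d))) atTop (𝓝 0) →
      Tendsto (fun n => eLpNorm (fun x => (1 / 2 * ψ n x + 1 / 2 * ψ' n x) -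
        (1 / 2 * f x + 1 / 2 * f' x)) (ENNReal.ofReal p)
        (volume.restrict (unitBall d))) atTop (𝓝 0) := by
    intro f f' ψ ψ' hψ hψ' hf hf' ht ht'
    have h0 := (ENNReal.Tendsto.const_mul ht (a := ENNReal.ofReal |1 / 2|) (Or.inr (by simp))).add
      (ENNReal.Tendsto.const_mul ht' (a := ENNReal.ofReal |1 / 2|) (Or.inr (by simp)))
    rw [mul_zero, add_zero] at h0
    refine tendsto_of_tendsto_of_tendsto_of_le_of_le tendsto_const_nhds h0 (fun _ => zero_le)
      fun n => ?_
    refine le_trans (le_of_eq ?_) (eLpNorm_linearCombination_le hq (1 / 2) (1 / 2)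
      ((hψ n).aestronglyMeasurable.sub hf) ((hψ' n).aestronglyMeasurable.sub hf'))
    congr 1
    ext x
    ring
  refine ⟨memLp_linearCombination _ _ hw hw', fun i x => 1 / 2 * G i x + 1 / 2 * G' i x,
    fun i => ⟨(hG i).1.linearCombination _ _ (hG' i).1,
      memLp_linearCombination _ _ (hG i).2 (hG' i).2⟩,
    fun n x => 1 / 2 * φ n x + 1 / 2 * φ' n x, fun n => ?_, ?_, fun i => ?_⟩
  · have h1 := (hφ n).const_mul (1 / 2)
    have h2 := (hφ' n).const_mul (-(1 / 2))
    have h3 := h1.sub h2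
    convert h3 using 2
    ring
  · exact hlim (fun n => (hφ n).1.continuous) (fun n => (hφ' n).1.continuous) hw.1 hw'.1 hφw hφw'
  · have hpd : ∀ n, (fun x => partialDeriv i (fun y => 1 / 2 * φ n y + 1 / 2 * φ' n y) x) =
        fun x => 1 / 2 * partialDeriv i (φ n) x + 1 / 2 * partialDeriv i (φ' n) x := fun n => by
      ext x
      have d1 := ((hφ n).1.differentiable (by simp)).differentiableAt (x := x)
      have d2 := ((hφ' n).1.differentiable (by simp)).differentiableAt (x := x)
      simp only [partialDeriv]
      rw [fderiv_fun_add (d1.const_mul _) (d2.const_mul _), fderiv_const_mul d1,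
        fderiv_const_mul d2]
      simp
    have := hlim (fun n => ((hφ n).directionalDeriv (EuclideanSpace.single i 1)).1.continuous)
      (fun n => ((hφ' n).directionalDeriv (EuclideanSpace.single i 1)).1.continuous)
      (hG i).2.1 (hG' i).2.1 (hφG i) (hφG' i)
    refine this.congr fun n => ?_
    congr 1
    ext x
    rw [congrFun (hpd n) x]
    rfl

theorem admissible_midpoint (hp : 1 < p) {g u v : Space d → ℝ} (hu : u ∈ admissible p g)
    (hv : v ∈ admissible p g) : (fun x => 1 / 2 * u x + 1 / 2 * v x) ∈ admissible p g := by
  obtain ⟨hu1, ⟨-, hu2⟩, hu3⟩ := hu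
  obtain ⟨hv1, ⟨-, hv2⟩, hv3⟩ := hv
  obtain ⟨G, H, hj⟩ := memW2_iff_exists_jet.1 hu1
  obtain ⟨G', H', hj'⟩ := memW2_iff_exists_jet.1 hv1
  have h1 : MemW2 p (unitBall d) (fun x => 1 / 2 * u x + 1 / 2 * v x) :=
    memW2_iff_exists_jet.2 ⟨_, _, hj.linearCombination (1 / 2) (1 / 2) hj'⟩
  refine ⟨h1, ⟨h1.memW2Loc Metric.isOpen_ball, ?_⟩, ?_⟩
  · have h2 := memW1Zero_midpoint hp hu2 hv2
    convert h2 using 2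
    ring
  · exact (hu3.smul (show (0 : ℝ) ≤ 1 / 2 by norm_num)).add
      (hv3.smul (show (0 : ℝ) ≤ 1 / 2 by norm_num))

theorem memW1Zero_zero (p : ℝ) : MemW1Zero p (unitBall d) fun _ => (0 : ℝ) := by
  have hz : MemLpOn p (unitBall d) fun _ => (0 : ℝ) := MemLp.zero'
  have hl : LocallyIntegrableOn (fun _ : Space d => (0 : ℝ)) (unitBall d) :=
    (integrable_zero (Space d) ℝ volume).integrableOn.locallyIntegrableOn
  refine ⟨hz, fun _ _ => 0, fun i => ⟨⟨hl, hl, fun φ _ => by simp⟩, hz⟩, fun _ _ => 0, fun _ => ?_,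
    ?_, fun i => ?_⟩
  · exact ⟨contDiff_const, HasCompactSupport.zero, by simp [tsupport]⟩
  · simp
  · simp [partialDeriv]

theorem mem_admissible_self {g : Space d → ℝ} (hg : MemW2 p (unitBall d) g)
    (hgconv : ConvexOn ℝ (unitBall d) g) : g ∈ admissible p g := by
  refine ⟨hg, ⟨hg.memW2Loc Metric.isOpen_ball, ?_⟩, hgconv⟩
  simpa using memW1Zero_zero (d := d) p

/-- All components of a jet as one family of functions. -/
def jetFamily (u : Space d → ℝ) (G : Fin d → Space d → ℝ) (H : Space d → SymMat d) :
    Unit ⊕ Fin d ⊕ Fin d × Fin d → Space d → ℝ :=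
  Sum.elim (fun _ => u) (Sum.elim G fun ij x => (H x : Matrix (Fin d) (Fin d) ℝ) ij.1 ij.2)

theorem IsW2Jet.memLp_jetFamily {u : Space d → ℝ} {G : Fin d → Space d → ℝ}
    {H : Space d → SymMat d} (h : IsW2Jet p u G H) (k : Unit ⊕ Fin d ⊕ Fin d × Fin d) :
    MemLp (jetFamily u G H k) (ENNReal.ofReal p) (volume.restrict (unitBall d)) := by
  rcases k with _ | i | ⟨i, j⟩
  · exact h.memLp
  · exact (h.grad i).2
  · exact (h.hess i j).2

theorem IsW2Jet.congr {u u' : Space d → ℝ} {G : Fin d → Space d → ℝ} {H : Space d → SymMat d}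
    (h : IsW2Jet p u G H) (huu' : u =ᵐ[volume.restrict (unitBall d)] u') : IsW2Jet p u' G H where
  memLp := (memLp_congr_ae huu').1 h.memLp
  grad i := ⟨(h.grad i).1.congr Metric.isOpen_ball huu', (h.grad i).2⟩
  hess := h.hess

/-- If the entries of symmetric matrices converge, they also converge to the symmetric part of the
limit, so that the limit of Hessians may be taken with symmetric values everywhere. -/
theorem tendsto_eLpNorm_sub_symmPart {α : Type*} [MeasurableSpace α] {μ : Measure α} {q : ℝ≥0∞}
    (hq : 1 ≤ q) {H : ℕ → α → SymMat d} {A : Fin d → Fin d → α → ℝ}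
    (hH : ∀ n i j, MemLp (fun x => (H n x : Matrix (Fin d) (Fin d) ℝ) i j) q μ)
    (hA : ∀ i j, MemLp (A i j) q μ)
    (h : ∀ i j, Tendsto (fun n => eLpNorm (fun x => (H n x : Matrix (Fin d) (Fin d) ℝ) i j - A i j x)
      q μ) atTop (𝓝 0)) (i j : Fin d) :
    Tendsto (fun n => eLpNorm (fun x => (H n x : Matrix (Fin d) (Fin d) ℝ) i j -
      (symmPart (fun i j => A i j x) : Matrix (Fin d) (Fin d) ℝ) i j) q μ) atTop (𝓝 0) := by
  have h0 := (ENNReal.Tendsto.const_mul (h i j) (a := ENNReal.ofReal |1 / 2|) (Or.inr (by simp))).add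
    (ENNReal.Tendsto.const_mul (h j i) (a := ENNReal.ofReal |1 / 2|) (Or.inr (by simp)))
  rw [mul_zero, add_zero] at h0
  refine tendsto_of_tendsto_of_tendsto_of_le_of_le tendsto_const_nhds h0 (fun _ => zero_le)
    fun n => ?_
  refine le_trans (le_of_eq ?_) (eLpNorm_linearCombination_le hq (1 / 2) (1 / 2)
    ((hH n i j).1.sub (hA i j).1) ((hH n j i).1.sub (hA j i).1))
  congr 1
  ext x
  simp only [symmPart_apply]
  rw [symMat_apply_comm (H n x) j i]
  ring

end Jets

/-! ### The energy -/

section Energy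

variable {d : ℕ} {p γp γm lam Lam : ℝ} {F : SymMat d → ℝ} {u : Space d → ℝ}
  {G : Fin d → Space d → ℝ} {H : Space d → SymMat d}

/-- The zero-order density `γ₊ max(s,0) - γ₋ min(s,0)`. -/
def zeroOrder (γp γm s : ℝ) : ℝ := γp * max s 0 - γm * min s 0

theorem zeroOrder_eq (γp γm s : ℝ) : zeroOrder γp γm s = (γp + γm) * max s 0 - γm * s := by
  have := max_add_min s 0
  rw [zeroOrder, show min s 0 = s - max s 0 by linarith]
  ring

theorem zeroOrder_midpoint_le (hγ : 0 ≤ γp + γm) (s t : ℝ) :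
    zeroOrder γp γm (1 / 2 * s + 1 / 2 * t) ≤
      1 / 2 * zeroOrder γp γm s + 1 / 2 * zeroOrder γp γm t := by
  simp only [zeroOrder_eq]
  have h : max (1 / 2 * s + 1 / 2 * t) 0 ≤ 1 / 2 * max s 0 + 1 / 2 * max t 0 := by
    refine max_le ?_ ?_
    · linarith [le_max_left s 0, le_max_left t 0]
    · linarith [le_max_right s 0, le_max_right t 0]
  nlinarith [mul_le_mul_of_nonneg_left h hγ]

theorem abs_zeroOrder_sub_le (γp γm s t : ℝ) :
    |zeroOrder γp γm s - zeroOrder γp γm t| ≤ (|γp + γm| + |γm|) * |s - t| := by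
  simp only [zeroOrder_eq]
  have h1 := abs_max_sub_max_le_abs s t 0
  calc |(γp + γm) * max s 0 - γm * s - ((γp + γm) * max t 0 - γm * t)|
      = |(γp + γm) * (max s 0 - max t 0) - γm * (s - t)| := by ring_nf
    _ ≤ |γp + γm| * |max s 0 - max t 0| + |γm| * |s - t| := by
        rw [← abs_mul, ← abs_mul]
        exact abs_sub _ _
    _ ≤ |γp + γm| * |s - t| + |γm| * |s - t| := by gcongr
    _ = _ := by ring

theorem abs_zeroOrder_le (γp γm s : ℝ) : |zeroOrder γp γm s| ≤ (|γp + γm| + |γm|) * |s| := by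
  simpa [zeroOrder] using abs_zeroOrder_sub_le γp γm s 0

theorem continuous_zeroOrder (γp γm : ℝ) : Continuous (zeroOrder γp γm) := by
  unfold zeroOrder
  fun_prop

theorem integrable_zeroOrder (hp : 1 < p) (hu : MemLpOn p (unitBall d) u) :
    IntegrableOn (fun x => zeroOrder γp γm (u x)) (unitBall d) := by
  refine ((hu.integrableOn hp).norm.const_mul (|γp + γm| + |γm|)).mono'
    ((continuous_zeroOrder γp γm).comp_aestronglyMeasurable hu.1) ?_
  exact Eventually.of_forall fun x => abs_zeroOrder_le γp γm (u x)

theorem UniformlyElliptic.memLp_comp (hF : UniformlyElliptic lam Lam F) (h : IsW2Jet p u G H) :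
    MemLpOn p (unitBall d) fun x => F (H x) := by
  obtain ⟨L, hL0, hL⟩ := hF.exists_lipschitz
  have h0 : MemLp (fun x => entrySum (H x)) (ENNReal.ofReal p) (volume.restrict (unitBall d)) :=
    memLp_finsetSum (f := fun i x => ∑ j, |(H x : Matrix (Fin d) (Fin d) ℝ) i j|) _ fun i _ =>
      memLp_finsetSum (f := fun j x => |(H x : Matrix (Fin d) (Fin d) ℝ) i j|) _ fun j _ =>
        (h.hess i j).2.norm
  have h1 := h0.const_mul L
  refine h1.mono (hF.aestronglyMeasurable_comp fun i j => (h.hess i j).2.1) ?_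
  refine Eventually.of_forall fun x => ?_
  have h2 := hL (H x) 0
  rw [hF.map_zero, sub_zero, sub_zero] at h2
  exact h2.trans (le_abs_self _)

theorem IsW2Jet.ae_nonneg (hp : 1 < p) (hF : UniformlyElliptic lam Lam F) (h : IsW2Jet p u G H)
    (hu : ConvexOn ℝ (unitBall d) u) : ∀ᵐ x ∂(volume.restrict (unitBall d)), 0 ≤ F (H x) :=
  (h.ae_posSemidef hp hu).mono fun _ hx => hF.nonneg_of_posSemidef hx

theorem IsW2Jet.ae_rpow_eq (hp : 1 < p) (hF : UniformlyElliptic lam Lam F) (h : IsW2Jet p u G H)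
    (hu : ConvexOn ℝ (unitBall d) u) :
    (fun x => F (H x) ^ p) =ᵐ[volume.restrict (unitBall d)] fun x => |F (H x)| ^ p :=
  (h.ae_nonneg hp hF hu).mono fun x hx => by simp only [abs_of_nonneg hx]

theorem IsW2Jet.integrable_rpow (hp : 1 < p) (hF : UniformlyElliptic lam Lam F)
    (h : IsW2Jet p u G H) (hu : ConvexOn ℝ (unitBall d) u) :
    IntegrableOn (fun x => F (H x) ^ p) (unitBall d) :=
  (integrable_congr (h.ae_rpow_eq hp hF hu)).2 (integrable_abs_rpow hp (hF.memLp_comp h))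

theorem IsW2Jet.energyDensity_ae_eq (h : IsW2Jet p u G H) :
    energyDensity F p γp γm u =ᵐ[volume.restrict (unitBall d)]
      fun x => F (H x) ^ p + zeroOrder γp γm (u x) :=
  h.weakHessian_ae_eq.mono fun x hx => by
    simp only [energyDensity, hx, zeroOrder]
    ring

theorem IsW2Jet.integrable_energyDensity (hp : 1 < p) (hF : UniformlyElliptic lam Lam F)
    (h : IsW2Jet p u G H) (hu : ConvexOn ℝ (unitBall d) u) :
    IntegrableOn (energyDensity F p γp γm u) (unitBall d) :=
  (integrable_congr h.energyDensity_ae_eq).2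
    ((h.integrable_rpow hp hF hu).add (integrable_zeroOrder hp h.memLp))

theorem IsW2Jet.energy_eq (hp : 1 < p) (hF : UniformlyElliptic lam Lam F)
    (h : IsW2Jet p u G H) (hu : ConvexOn ℝ (unitBall d) u) :
    energy F p γp γm u =
      (∫ x in unitBall d, F (H x) ^ p) + ∫ x in unitBall d, zeroOrder γp γm (u x) := by
  rw [energy, integral_congr_ae h.energyDensity_ae_eq]
  exact integral_add (h.integrable_rpow hp hF hu) (integrable_zeroOrder hp h.memLp)

/-- The energy is midpoint convex: `F` is convex and nonnegative on Hessians of convex functions,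
`t ↦ t ^ p` is convex and increasing on `[0, ∞)`, and the slope `-γ₋` of the zero-order density on
the negative axis is at most its slope `γ₊` on the positive axis. -/
theorem energy_midpoint_le (hp : 1 < p) (hγ : 0 ≤ γp + γm) (hF : UniformlyElliptic lam Lam F)
    (hFconv : ConvexOn ℝ univ F) {v : Space d → ℝ} {G' : Fin d → Space d → ℝ}
    {H' : Space d → SymMat d} (h : IsW2Jet p u G H) (h' : IsW2Jet p v G' H')
    (hu : ConvexOn ℝ (unitBall d) u) (hv : ConvexOn ℝ (unitBall d) v) :
    energy F p γp γm (fun x => 1 / 2 * u x + 1 / 2 * v x) ≤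
      1 / 2 * energy F p γp γm u + 1 / 2 * energy F p γp γm v := by
  have hm := h.linearCombination (1 / 2) (1 / 2) h'
  have hmc : ConvexOn ℝ (unitBall d) (fun x => 1 / 2 * u x + 1 / 2 * v x) :=
    (hu.smul (show (0 : ℝ) ≤ 1 / 2 by norm_num)).add (hv.smul (show (0 : ℝ) ≤ 1 / 2 by norm_num))
  rw [h.energy_eq hp hF hu, h'.energy_eq hp hF hv, hm.energy_eq hp hF hmc]
  have i1 : ∫ x in unitBall d, F ((1 / 2 : ℝ) • H x + (1 / 2 : ℝ) • H' x) ^ p ≤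
      1 / 2 * (∫ x in unitBall d, F (H x) ^ p) + 1 / 2 * ∫ x in unitBall d, F (H' x) ^ p := by
    have j1 := (h.integrable_rpow hp hF hu).const_mul (1 / 2)
    have j2 := (h'.integrable_rpow hp hF hv).const_mul (1 / 2)
    rw [← integral_const_mul, ← integral_const_mul, ← integral_add j1 j2]
    refine integral_mono_ae (hm.integrable_rpow hp hF hmc) (j1.add j2) ?_
    filter_upwards [h.ae_nonneg hp hF hu, h'.ae_nonneg hp hF hv, hm.ae_nonneg hp hF hmc]
      with x hx hx' hxm
    have c1 := hFconv.2 (mem_univ (H x)) (mem_univ (H' x)) (show (0 : ℝ) ≤ 1 / 2 by norm_num)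
      (show (0 : ℝ) ≤ 1 / 2 by norm_num) (by norm_num)
    have c2 := (convexOn_rpow hp.le).2 (show F (H x) ∈ Ici (0 : ℝ) from hx)
      (show F (H' x) ∈ Ici (0 : ℝ) from hx') (show (0 : ℝ) ≤ 1 / 2 by norm_num)
      (show (0 : ℝ) ≤ 1 / 2 by norm_num) (by norm_num)
    exact (Real.rpow_le_rpow hxm c1 (by linarith)).trans c2
  have i2 : ∫ x in unitBall d, zeroOrder γp γm (1 / 2 * u x + 1 / 2 * v x) ≤
      1 / 2 * (∫ x in unitBall d, zeroOrder γp γm (u x)) +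
        1 / 2 * ∫ x in unitBall d, zeroOrder γp γm (v x) := by
    have j1 := (integrable_zeroOrder (γp := γp) (γm := γm) hp h.memLp).const_mul (1 / 2)
    have j2 := (integrable_zeroOrder (γp := γp) (γm := γm) hp h'.memLp).const_mul (1 / 2)
    rw [← integral_const_mul, ← integral_const_mul, ← integral_add j1 j2]
    exact integral_mono (integrable_zeroOrder hp hm.memLp) (j1.add j2)
      fun x => zeroOrder_midpoint_le hγ _ _
  linarith

theorem toReal_eLpNorm_rpow {α : Type*} [MeasurableSpace α] {μ : Measure α} (hp : 1 < p)
    {f : α → ℝ} (hf : MemLp f (ENNReal.ofReal p) μ) :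
    ∫ x, |f x| ^ p ∂μ = (eLpNorm f (ENNReal.ofReal p) μ).toReal ^ p := by
  have hnn : 0 ≤ ∫ x, |f x| ^ p ∂μ := integral_nonneg fun x => Real.rpow_nonneg (abs_nonneg _) p
  rw [eLpNorm_eq_ofReal_integral hp hf, ENNReal.toReal_ofReal (Real.rpow_nonneg hnn _),
    ← Real.rpow_mul hnn, one_div_mul_cancel (by linarith), Real.rpow_one]

theorem IsW2Jet.integral_rpow_eq (hp : 1 < p) (hF : UniformlyElliptic lam Lam F)
    (h : IsW2Jet p u G H) (hu : ConvexOn ℝ (unitBall d) u) :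
    ∫ x in unitBall d, F (H x) ^ p = (eLpNorm (fun x => F (H x)) (ENNReal.ofReal p)
      (volume.restrict (unitBall d))).toReal ^ p := by
  rw [integral_congr_ae (h.ae_rpow_eq hp hF hu)]
  exact toReal_eLpNorm_rpow hp (hF.memLp_comp h)

/-! ### Coercivity -/

theorem IsW2Jet.eLpNorm_hess_le (hp : 1 < p) (hF : UniformlyElliptic lam Lam F)
    (h : IsW2Jet p u G H) (hu : ConvexOn ℝ (unitBall d) u) (i j : Fin d) :
    eLpNorm (fun x => (H x : Matrix (Fin d) (Fin d) ℝ) i j) (ENNReal.ofReal p)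
      (volume.restrict (unitBall d)) ≤ ENNReal.ofReal lam⁻¹ *
        eLpNorm (fun x => F (H x)) (ENNReal.ofReal p) (volume.restrict (unitBall d)) := by
  refine eLpNorm_le_mul_eLpNorm_of_ae_le_mul ?_ _
  filter_upwards [h.ae_posSemidef hp hu] with x hx
  have h1 := hF.le_of_posSemidef hx
  rw [← div_eq_inv_mul, le_div_iff₀ hF.pos, mul_comm]
  exact (mul_le_mul_of_nonneg_left (abs_apply_le_specNorm (H x) i j) hF.pos.le).trans
    (h1.trans (le_abs_self _))

/-- The full `W^{2,p}` norm of an admissible function is controlled by the norm of `F(D²u)`. -/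
theorem exists_jet_bound (hd : 1 ≤ d) (hp : 1 < p) (hF : UniformlyElliptic lam Lam F)
    {g : Space d → ℝ} (hg : MemW2 p (unitBall d) g) : ∃ K : ℝ≥0∞, K ≠ ⊤ ∧
    ∀ u G H, u ∈ admissible p g → IsW2Jet p u G H → ∀ k,
      eLpNorm (jetFamily u G H k) (ENNReal.ofReal p) (volume.restrict (unitBall d)) ≤
        K * (1 + eLpNorm (fun x => F (H x)) (ENNReal.ofReal p)
          (volume.restrict (unitBall d))) := by
  have hq := ENNReal.one_le_ofReal.2 hp.le
  obtain ⟨Gg, Hg, hjg⟩ := memW2_iff_exists_jet.1 hg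
  obtain ⟨C, hCt, hC⟩ := exists_sobolev_bound hd hp
  set N : (Space d → ℝ) → ℝ≥0∞ := fun f =>
    eLpNorm f (ENNReal.ofReal p) (volume.restrict (unitBall d)) with hN
  -- the constant that bounds the jet of the boundary datum
  set B : ℝ≥0∞ := ∑ k, N (jetFamily g Gg Hg k) with hB
  have hBt : B ≠ ⊤ := ENNReal.sum_ne_top.2 fun k _ => (hjg.memLp_jetFamily k).2.ne
  have hNB : ∀ k, N (jetFamily g Gg Hg k) ≤ B := fun k =>
    Finset.single_le_sum (f := fun k => N (jetFamily g Gg Hg k)) (fun _ _ => zero_le)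
      (Finset.mem_univ k)
  set c : ℝ≥0∞ := ENNReal.ofReal lam⁻¹ with hc
  -- the number of second derivatives
  set D : ℝ≥0∞ := (d : ℝ≥0∞) * d with hD
  have hDt : D ≠ ⊤ := ENNReal.mul_ne_top (by simp) (by simp)
  refine ⟨C * (D * (c + B)) + B + c, ?_, ?_⟩
  · have : c ≠ ⊤ := ENNReal.ofReal_ne_top
    finiteness
  intro u G H hu h
  set X := N fun x => F (H x) with hX
  have hHle : ∀ i j, N (fun x => (H x : Matrix (Fin d) (Fin d) ℝ) i j) ≤ c * X := fun i j =>
    h.eLpNorm_hess_le hp hF hu.2.2 i j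
  have hw := h.linearCombination 1 (-1) hjg
  have hw0 : MemW1Zero p (unitBall d) (fun x => 1 * u x + -1 * g x) := by
    convert hu.2.1.2 using 2
    ring
  have hsub : ∀ {f f' : Space d → ℝ}, MemLpOn p (unitBall d) f → MemLpOn p (unitBall d) f' →
      N (fun x => 1 * f x + -1 * f' x) ≤ N f + N f' := fun hf hf' => by
    simpa using eLpNorm_linearCombination_le hq 1 (-1) hf.1 hf'.1
  have hadd : ∀ {f f' : Space d → ℝ}, MemLpOn p (unitBall d) f → MemLpOn p (unitBall d) f' →
      N f ≤ N (fun x => 1 * f x + -1 * f' x) + N f' := fun {f f'} hf hf' => by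
    have h1 := eLpNorm_linearCombination_le hq 1 1
      (memLp_linearCombination 1 (-1) hf hf').1 hf'.1
    simp only [abs_one, ENNReal.ofReal_one, one_mul] at h1
    refine le_trans (le_of_eq ?_) (h1.trans (le_of_eq ?_))
    · simp only [hN]
      congr 1
      ext x
      ring
    · simp only [hN, one_mul]
  obtain ⟨hb0, hb1⟩ := hC _ _ (fun i j x => 1 * (H x : Matrix (Fin d) (Fin d) ℝ) i j +
    -1 * (Hg x : Matrix (Fin d) (Fin d) ℝ) i j) hw0 hw.grad hw.hess
  have hsum : ∑ i : Fin d, ∑ j : Fin d, N (fun x => 1 * (H x : Matrix (Fin d) (Fin d) ℝ) i j +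
      -1 * (Hg x : Matrix (Fin d) (Fin d) ℝ) i j) ≤ D * (c * X + B) := by
    calc _ ≤ ∑ i : Fin d, ∑ j : Fin d, (c * X + B) := by
          gcongr with i _ j _
          exact (hsub (h.hess i j).2 (hjg.hess i j).2).trans
            (add_le_add (hHle i j) (hNB (.inr (.inr (i, j)))))
      _ = _ := by
          simp only [Finset.sum_const, Finset.card_univ, Fintype.card_fin, nsmul_eq_mul, hD]
          ring
  have hcX : c * X + B ≤ (c + B) * (1 + X) := by
    rw [add_mul, mul_add, mul_add]
    gcongr
    · exact le_add_left le_rfl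
    · rw [mul_one]; exact le_add_right le_rfl
  have h1X : 1 ≤ 1 + X := le_add_right le_rfl
  have hlow : C * (D * (c * X + B)) + B ≤ (C * (D * (c + B)) + B + c) * (1 + X) := by
    calc C * (D * (c * X + B)) + B ≤ C * (D * ((c + B) * (1 + X))) + B * (1 + X) := by
          gcongr
          exact le_mul_of_one_le_right zero_le h1X
      _ = (C * (D * (c + B)) + B) * (1 + X) := by ring
      _ ≤ _ := by
          exact mul_le_mul_left (le_add_right le_rfl) _
  intro k
  rcases k with _ | i | ⟨i, j⟩
  · refine le_trans ?_ hlow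
    refine (hadd h.memLp hjg.memLp).trans (add_le_add (hb0.trans ?_) (hNB (.inl ())))
    exact mul_le_mul_right hsum C
  · refine le_trans ?_ hlow
    refine (hadd (h.grad i).2 (hjg.grad i).2).trans
      (add_le_add ((hb1 i).trans ?_) (hNB (.inr (.inl i))))
    exact mul_le_mul_right hsum C
  · refine (hHle i j).trans ?_
    gcongr
    · exact le_add_left le_rfl
    · exact le_add_left le_rfl

theorem exists_mul_le_rpow_add (hp : 1 < p) (K : ℝ) (hK : 0 ≤ K) :
    ∃ C : ℝ, ∀ X : ℝ, 0 ≤ X → K * X ≤ X ^ p + C := by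
  have hp1 : 0 < p - 1 := by linarith
  -- beyond `R` the power dominates the linear function
  set R := K ^ (1 / (p - 1)) with hR
  have hR0 : 0 ≤ R := Real.rpow_nonneg hK _
  refine ⟨K * R, fun X hX => ?_⟩
  by_cases h : X ≤ R
  · have := Real.rpow_nonneg hX p
    nlinarith [mul_le_mul_of_nonneg_left h hK]
  · push Not at h
    have hX0 : 0 < X := hR0.trans_lt h
    have h1 : K ≤ X ^ (p - 1) := by
      calc K = R ^ (p - 1) := by
            rw [hR, ← Real.rpow_mul hK, one_div_mul_cancel hp1.ne', Real.rpow_one]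
        _ ≤ X ^ (p - 1) := Real.rpow_le_rpow hR0 h.le hp1.le
    have h2 : X ^ p = X ^ (p - 1) * X := by
      rw [← Real.rpow_add_one hX0.ne', sub_add_cancel]
    rw [h2]
    nlinarith [mul_le_mul_of_nonneg_right h1 hX, mul_nonneg hK hR0]

/-- Coercivity: the zero-order part of the energy grows at most linearly in the norm of `F(D²u)`,
while the leading part is its `p`-th power. -/
theorem exists_coercive (hd : 1 ≤ d) (hp : 1 < p) (hF : UniformlyElliptic lam Lam F)
    {g : Space d → ℝ} (hg : MemW2 p (unitBall d) g) (γp γm : ℝ) : ∃ M : ℝ,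
    ∀ u G H, u ∈ admissible p g → IsW2Jet p u G H →
      (eLpNorm (fun x => F (H x)) (ENNReal.ofReal p) (volume.restrict (unitBall d))).toReal ≤
        energy F p γp γm u + M := by
  obtain ⟨K, hKt, hK⟩ := exists_jet_bound hd hp hF hg
  have hq := ENNReal.one_le_ofReal.2 hp.le
  -- `v` is the constant of the embedding of `L^p` into `L^1` of the ball
  set e : ℝ := 1 / (1 : ℝ≥0∞).toReal - 1 / (ENNReal.ofReal p).toReal with he
  set v : ℝ≥0∞ := (volume.restrict (unitBall d)) univ ^ e with hv
  have hvt : v ≠ ⊤ := by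
    refine ENNReal.rpow_ne_top_of_nonneg ?_ (measure_ne_top _ _)
    rw [he, ENNReal.toReal_ofReal (by linarith), ENNReal.toReal_one, div_one, sub_nonneg]
    exact (div_le_one (by linarith)).2 hp.le
  set Γ := |γp + γm| + |γm| with hΓ
  have hΓ0 : 0 ≤ Γ := by positivity
  set K' := Γ * (K.toReal * v.toReal) with hK'
  have hK'0 : 0 ≤ K' := by positivity
  obtain ⟨C, hC⟩ := exists_mul_le_rpow_add hp (K' + 1) (by positivity)
  refine ⟨K' + C, fun u G H hu h => ?_⟩
  have hFLp := hF.memLp_comp h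
  set X := eLpNorm (fun x => F (H x)) (ENNReal.ofReal p) (volume.restrict (unitBall d)) with hX
  have hXt : X ≠ ⊤ := hFLp.2.ne
  have h1 := hC X.toReal ENNReal.toReal_nonneg
  have h2 : ∫ x in unitBall d, ‖u x‖ ≤ K.toReal * (1 + X.toReal) * v.toReal := by
    have h3 : eLpNorm u 1 (volume.restrict (unitBall d)) ≤ K * (1 + X) * v := by
      refine (eLpNorm_le_eLpNorm_mul_rpow_measure_univ hq h.memLp.1).trans ?_
      gcongr
      exact hK u G H hu h (.inl ())
    have h4 : ∫ x in unitBall d, ‖u x‖ = (eLpNorm u 1 (volume.restrict (unitBall d))).toReal := by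
      rw [eLpNorm_one_eq_lintegral_enorm, integral_norm_eq_lintegral_enorm h.memLp.1]
    rw [h4]
    have h5 := ENNReal.toReal_mono (by finiteness) h3
    rwa [ENNReal.toReal_mul, ENNReal.toReal_mul, ENNReal.toReal_add (by simp) hXt,
      ENNReal.toReal_one] at h5
  have h6 : -(Γ * ∫ x in unitBall d, ‖u x‖) ≤ ∫ x in unitBall d, zeroOrder γp γm (u x) := by
    rw [← integral_const_mul, ← integral_neg]
    refine integral_mono ((h.memLp.integrableOn hp).norm.const_mul Γ).neg
      (integrable_zeroOrder hp h.memLp) fun x => ?_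
    exact (abs_le.1 (abs_zeroOrder_le γp γm (u x))).1
  have h7 := h.energy_eq (γp := γp) (γm := γm) hp hF hu.2.2
  rw [h.integral_rpow_eq hp hF hu.2.2] at h7
  have h8 : Γ * ∫ x in unitBall d, ‖u x‖ ≤ K' * (1 + X.toReal) := by
    calc _ ≤ Γ * (K.toReal * (1 + X.toReal) * v.toReal) := by gcongr
      _ = _ := by rw [hK']; ring
  rw [h7]
  linarith

/-! ### Continuity of the energy -/

theorem tendsto_eLpNorm_comp (hp : 1 < p) (hF : UniformlyElliptic lam Lam F)
    {H : ℕ → Space d → SymMat d} {H' : Space d → SymMat d}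
    (hH : ∀ n i j, MemLpOn p (unitBall d) fun x => (H n x : Matrix (Fin d) (Fin d) ℝ) i j)
    (hH' : ∀ i j, MemLpOn p (unitBall d) fun x => (H' x : Matrix (Fin d) (Fin d) ℝ) i j)
    (ht : ∀ i j, Tendsto (fun n => eLpNorm (fun x => (H n x : Matrix (Fin d) (Fin d) ℝ) i j -
      (H' x : Matrix (Fin d) (Fin d) ℝ) i j) (ENNReal.ofReal p) (volume.restrict (unitBall d)))
      atTop (𝓝 0)) :
    Tendsto (fun n => eLpNorm (fun x => F (H n x) - F (H' x)) (ENNReal.ofReal p)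
      (volume.restrict (unitBall d))) atTop (𝓝 0) := by
  obtain ⟨L, hL0, hL⟩ := hF.exists_lipschitz
  have hq := ENNReal.one_le_ofReal.2 hp.le
  have h0 : Tendsto (fun n => ENNReal.ofReal L * (2 * ∑ ij : Fin d × Fin d,
      eLpNorm (fun x => (H n x : Matrix (Fin d) (Fin d) ℝ) ij.1 ij.2 -
        (H' x : Matrix (Fin d) (Fin d) ℝ) ij.1 ij.2) (ENNReal.ofReal p)
        (volume.restrict (unitBall d)))) atTop (𝓝 0) := by
    have h1 := tendsto_finsetSum (Finset.univ : Finset (Fin d × Fin d)) fun ij _ => ht ij.1 ij.2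
    have h2 := ENNReal.Tendsto.const_mul (ENNReal.Tendsto.const_mul h1 (a := 2) (Or.inr (by simp)))
      (a := ENNReal.ofReal L) (Or.inr ENNReal.ofReal_ne_top)
    simpa using h2
  refine tendsto_of_tendsto_of_tendsto_of_le_of_le tendsto_const_nhds h0 (fun _ => zero_le)
    fun n => ?_
  have h3 := eLpNorm_two_mul_sum_abs_le hq (μ := volume.restrict (unitBall d))
    (G := fun (ij : Fin d × Fin d) x => (H n x : Matrix (Fin d) (Fin d) ℝ) ij.1 ij.2 -
        (H' x : Matrix (Fin d) (Fin d) ℝ) ij.1 ij.2) fun ij => (hH n ij.1 ij.2).sub (hH' ij.1 ij.2)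
  refine le_trans (eLpNorm_le_mul_eLpNorm_of_ae_le_mul (Eventually.of_forall fun x => ?_) _)
    (mul_le_mul_right h3 _)
  have h4 := hL (H n x) (H' x)
  have h5 : entrySum (H n x - H' x) = ∑ ij : Fin d × Fin d,
      |(H n x : Matrix (Fin d) (Fin d) ℝ) ij.1 ij.2 -
        (H' x : Matrix (Fin d) (Fin d) ℝ) ij.1 ij.2| := by
    rw [Fintype.sum_prod_type]
    rfl
  rw [h5] at h4
  refine h4.trans (mul_le_mul_of_nonneg_left ?_ hL0)
  refine le_trans ?_ (le_abs_self _)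
  have : 0 ≤ ∑ ij : Fin d × Fin d, |(H n x : Matrix (Fin d) (Fin d) ℝ) ij.1 ij.2 -
        (H' x : Matrix (Fin d) (Fin d) ℝ) ij.1 ij.2| := Finset.sum_nonneg fun _ _ => abs_nonneg _
  linarith

theorem tendsto_toReal_eLpNorm {α : Type*} [MeasurableSpace α] {μ : Measure α} {q : ℝ≥0∞}
    (hq : 1 ≤ q) {f : ℕ → α → ℝ} {g : α → ℝ} (hf : ∀ n, MemLp (f n) q μ) (hg : MemLp g q μ)
    (h : Tendsto (fun n => eLpNorm (fun x => f n x - g x) q μ) atTop (𝓝 0)) :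
    Tendsto (fun n => (eLpNorm (f n) q μ).toReal) atTop (𝓝 (eLpNorm g q μ).toReal) := by
  have : Fact (1 ≤ q) := ⟨hq⟩
  have h1 : Tendsto (fun n => (hf n).toLp (f n)) atTop (𝓝 (hg.toLp g)) :=
    (Lp.tendsto_Lp_iff_tendsto_eLpNorm'' _ hf _ hg).2 h
  simpa only [Lp.norm_toLp] using h1.norm

/-- The energy is continuous along strongly convergent sequences of jets of convex functions. -/
theorem tendsto_energy (hp : 1 < p) (hF : UniformlyElliptic lam Lam F)
    {u : ℕ → Space d → ℝ} {G : ℕ → Fin d → Space d → ℝ} {H : ℕ → Space d → SymMat d}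
    {u' : Space d → ℝ} {G' : Fin d → Space d → ℝ} {H' : Space d → SymMat d}
    (h : ∀ n, IsW2Jet p (u n) (G n) (H n)) (h' : IsW2Jet p u' G' H')
    (hu : ∀ n, ConvexOn ℝ (unitBall d) (u n)) (hu' : ConvexOn ℝ (unitBall d) u')
    (htu : Tendsto (fun n => eLpNorm (fun x => u n x - u' x) (ENNReal.ofReal p)
      (volume.restrict (unitBall d))) atTop (𝓝 0))
    (htH : ∀ i j, Tendsto (fun n => eLpNorm (fun x => (H n x : Matrix (Fin d) (Fin d) ℝ) i j -
      (H' x : Matrix (Fin d) (Fin d) ℝ) i j) (ENNReal.ofReal p) (volume.restrict (unitBall d)))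
      atTop (𝓝 0)) :
    Tendsto (fun n => energy F p γp γm (u n)) atTop (𝓝 (energy F p γp γm u')) := by
  have hq := ENNReal.one_le_ofReal.2 hp.le
  have e1 : ∀ n, energy F p γp γm (u n) = _ := fun n => (h n).energy_eq hp hF (hu n)
  simp only [e1, h'.energy_eq hp hF hu', (h _).integral_rpow_eq hp hF (hu _),
    h'.integral_rpow_eq hp hF hu']
  refine Tendsto.add ?_ ?_
  · refine Tendsto.rpow_const ?_ (Or.inr (by linarith))
    exact tendsto_toReal_eLpNorm hq (fun n => hF.memLp_comp (h n)) (hF.memLp_comp h')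
      (tendsto_eLpNorm_comp hp hF (fun n i j => ((h n).hess i j).2) (fun i j => (h'.hess i j).2) htH)
  · refine tendsto_integral_of_L1' _ (integrable_zeroOrder hp h'.memLp).1
      (Eventually.of_forall fun n => integrable_zeroOrder hp (h n).memLp) ?_
    have h1 := tendsto_eLpNorm_one hq (fun n => (h n).memLp.1.sub h'.memLp.1) htu
    have h2 := ENNReal.Tendsto.const_mul h1 (a := ENNReal.ofReal (|γp + γm| + |γm|))
      (Or.inr ENNReal.ofReal_ne_top)
    rw [mul_zero] at h2
    refine tendsto_of_tendsto_of_tendsto_of_le_of_le tendsto_const_nhds h2 (fun _ => zero_le)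
      fun n => ?_
    exact eLpNorm_le_mul_eLpNorm_of_ae_le_mul
      (Eventually.of_forall fun x => abs_zeroOrder_sub_le γp γm _ _) 1

end Energy

/-! ### Existence of a minimizer -/

section Minimizer

variable {d : ℕ} {p γp γm lam Lam : ℝ} {F : SymMat d → ℝ}

/-- The admissible class is closed under strong convergence of jets, up to a change of the limit on
a null set that makes it convex. -/
theorem exists_admissible_limit (hp : 1 < p) {g : Space d → ℝ} (hg : MemW2 p (unitBall d) g)
    {u : ℕ → Space d → ℝ} {G : ℕ → Fin d → Space d → ℝ} {H : ℕ → Space d → SymMat d}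
    (hu : ∀ n, u n ∈ admissible p g) (hj : ∀ n, IsW2Jet p (u n) (G n) (H n))
    {f : Unit ⊕ Fin d ⊕ Fin d × Fin d → Space d → ℝ}
    (hf : ∀ k, MemLp (f k) (ENNReal.ofReal p) (volume.restrict (unitBall d)))
    (ht : ∀ k, Tendsto (fun n => eLpNorm (fun x => jetFamily (u n) (G n) (H n) k x - f k x)
      (ENNReal.ofReal p) (volume.restrict (unitBall d))) atTop (𝓝 0)) :
    ∃ u' G' H', u' ∈ admissible p g ∧ IsW2Jet p u' G' H' ∧
      Tendsto (fun n => eLpNorm (fun x => u n x - u' x) (ENNReal.ofReal p)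
        (volume.restrict (unitBall d))) atTop (𝓝 0) ∧
      ∀ i j, Tendsto (fun n => eLpNorm (fun x => (H n x : Matrix (Fin d) (Fin d) ℝ) i j -
        (H' x : Matrix (Fin d) (Fin d) ℝ) i j) (ENNReal.ofReal p)
        (volume.restrict (unitBall d))) atTop (𝓝 0) := by
  have hq := ENNReal.one_le_ofReal.2 hp.le
  set v : Space d → ℝ := f (.inl ()) with hv
  set G' : Fin d → Space d → ℝ := fun i => f (.inr (.inl i)) with hG'
  set H' : Space d → SymMat d := fun x => symmPart fun i j => f (.inr (.inr (i, j))) x with hH'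
  have htu : Tendsto (fun n => eLpNorm (fun x => u n x - v x) (ENNReal.ofReal p)
    (volume.restrict (unitBall d))) atTop (𝓝 0) := ht (.inl ())
  have htG : ∀ i, Tendsto (fun n => eLpNorm (fun x => G n i x - G' i x) (ENNReal.ofReal p)
    (volume.restrict (unitBall d))) atTop (𝓝 0) := fun i => ht (.inr (.inl i))
  have htH : ∀ i j, Tendsto (fun n => eLpNorm (fun x => (H n x : Matrix (Fin d) (Fin d) ℝ) i j -
      (H' x : Matrix (Fin d) (Fin d) ℝ) i j) (ENNReal.ofReal p)
      (volume.restrict (unitBall d))) atTop (𝓝 0) :=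
    tendsto_eLpNorm_sub_symmPart hq (A := fun i j => f (.inr (.inr (i, j))))
      (fun n i j => ((hj n).hess i j).2) (fun i j => hf _) fun i j => ht (.inr (.inr (i, j)))
  have hGLp : ∀ i, MemLpOn p (unitBall d) (G' i) := fun i => hf _
  have hHLp : ∀ i j, MemLpOn p (unitBall d) fun x => (H' x : Matrix (Fin d) (Fin d) ℝ) i j :=
    fun i j => memLp_midpoint (hf (.inr (.inr (i, j)))) (hf (.inr (.inr (j, i))))
  have hjv : IsW2Jet p v G' H' :=
    { memLp := hf _
      grad := fun i => ⟨hasWeakPartial_of_tendsto hp (fun n => ((hj n).grad i).1)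
        (fun n => (hj n).memLp) (fun n => ((hj n).grad i).2) (hf _) (hGLp i) htu (htG i), hGLp i⟩
      hess := fun i j => ⟨hasWeakPartial_of_tendsto hp (fun n => ((hj n).hess i j).1)
        (fun n => ((hj n).grad i).2) (fun n => ((hj n).hess i j).2) (hGLp i) (hHLp i j) (htG i)
        (htH i j), hHLp i j⟩ }
  obtain ⟨ns, -, hns⟩ := (tendstoInMeasure_of_tendsto_eLpNorm (by simp; linarith)
    (fun n => (hj n).memLp.1) hjv.memLp.1 htu).exists_seq_tendsto_ae
  obtain ⟨u', hu'conv, huv⟩ := exists_convexOn_ae_eq Metric.isOpen_ball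
    (fun n => (hu (ns n)).2.2) hns
  have hju := hjv.congr huv
  have htu' : Tendsto (fun n => eLpNorm (fun x => u n x - u' x) (ENNReal.ofReal p)
      (volume.restrict (unitBall d))) atTop (𝓝 0) :=
    htu.congr fun n => eLpNorm_congr_ae ((EventuallyEq.refl _ (u n)).sub huv)
  have hW2 := memW2_iff_exists_jet.2 ⟨G', H', hju⟩
  refine ⟨u', G', H', ⟨hW2, ⟨hW2.memW2Loc Metric.isOpen_ball, ?_⟩, hu'conv⟩, hju, htu', htH⟩
  -- closedness of the boundary class, for the differences with `g`
  obtain ⟨Gg, Hg, hjg⟩ := memW2_iff_exists_jet.1 hg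
  have e1 : ∀ a b : ℝ, 1 * a + -1 * b = a - b := fun a b => by ring
  have hd := fun n => (hj n).linearCombination 1 (-1) hjg
  have hd' := hju.linearCombination 1 (-1) hjg
  simp only [e1] at hd hd'
  refine memW1Zero_of_tendsto hp (fun n => (hu n).2.1.2) (fun n i => ((hd n).grad i).1) hd'.memLp
    hd'.grad ?_ fun i => ?_
  · simpa only [sub_sub_sub_cancel_right] using htu'
  · simpa only [sub_sub_sub_cancel_right] using htG i

/-- The direct method. On the sublevel sets `energy ≤ inf + 1/(n+1)`, which are midpoint convex and
bounded in `W^{2,p}`, there is a strongly convergent selection of jets; its limit is a minimizer. -/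
theorem exists_minimizer (hd : 1 ≤ d) (hp : 1 < p) (hγ : 0 ≤ γp + γm)
    (hF : UniformlyElliptic lam Lam F) (hFconv : ConvexOn ℝ univ F)
    {g : Space d → ℝ} (hg : MemW2 p (unitBall d) g) (hgconv : ConvexOn ℝ (unitBall d) g) :
    ∃ uStar ∈ admissible p g, ∀ u ∈ admissible p g,
      energy F p γp γm uStar ≤ energy F p γp γm u := by
  obtain ⟨M, hM⟩ := exists_coercive hd hp hF hg γp γm
  obtain ⟨K, hKt, hK⟩ := exists_jet_bound hd hp hF hg
  set E : Set ℝ := energy F p γp γm '' admissible p g with hE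
  have hEne : E.Nonempty := ⟨_, mem_image_of_mem _ (mem_admissible_self hg hgconv)⟩
  have hEbdd : BddBelow E := by
    refine ⟨-M, ?_⟩
    rintro _ ⟨u, hu, rfl⟩
    obtain ⟨G, H, h⟩ := memW2_iff_exists_jet.1 hu.1
    have h1 := hM u G H hu h
    have h2 : (0 : ℝ) ≤ (eLpNorm (fun x => F (H x)) (ENNReal.ofReal p)
      (volume.restrict (unitBall d))).toReal := ENNReal.toReal_nonneg
    linarith
  set m := sInf E with hm
  let S : ℕ → Set (Unit ⊕ Fin d ⊕ Fin d × Fin d → Space d → ℝ) := fun n =>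
    {f | ∃ u G H, u ∈ admissible p g ∧ IsW2Jet p u G H ∧
      energy F p γp γm u ≤ m + 1 / ((n : ℝ) + 1) ∧ f = jetFamily u G H}
  have hanti : Antitone S := by
    rintro n n' hnn' f ⟨u, G, H, hu, hj, hle, rfl⟩
    refine ⟨u, G, H, hu, hj, hle.trans ?_, rfl⟩
    gcongr
  have hne : ∀ n, (S n).Nonempty := fun n => by
    obtain ⟨_, ⟨u, hu, rfl⟩, hlt⟩ := exists_lt_of_csInf_lt hEne
      (show sInf E < m + 1 / ((n : ℝ) + 1) by
        have : (0 : ℝ) < 1 / ((n : ℝ) + 1) := by positivity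
        linarith)
    obtain ⟨G, H, h⟩ := memW2_iff_exists_jet.1 hu.1
    exact ⟨_, u, G, H, hu, h, hlt.le, rfl⟩
  have hmid : ∀ n, ∀ f ∈ S n, ∀ f' ∈ S n, (fun k x => (f k x + f' k x) / 2) ∈ S n := by
    rintro n f ⟨u, G, H, hu, hj, hle, rfl⟩ f' ⟨u', G', H', hu', hj', hle', rfl⟩
    refine ⟨_, _, _, admissible_midpoint hp hu hu', hj.linearCombination (1 / 2) (1 / 2) hj',
      (energy_midpoint_le hp hγ hF hFconv hj hj' hu.2.2 hu'.2.2).trans (by linarith), ?_⟩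
    ext k x
    rcases k with _ | i | ⟨i, j⟩
    · simp only [jetFamily, Sum.elim_inl]
      ring
    · simp only [jetFamily, Sum.elim_inl, Sum.elim_inr]
      ring
    · simp only [jetFamily, Sum.elim_inr, Submodule.coe_add, Submodule.coe_smul, Matrix.add_apply,
        Matrix.smul_apply, smul_eq_mul]
      ring
  have hLp : ∀ f ∈ S 0, ∀ k, MemLp (f k) (ENNReal.ofReal p) (volume.restrict (unitBall d)) := by
    rintro f ⟨u, G, H, hu, hj, hle, rfl⟩
    exact hj.memLp_jetFamily
  -- on `S 0` the energy is at most `m + 1`, hence `‖F(D²u)‖_p ≤ m + 1 + M`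
  have hR : ∀ f ∈ S 0, powerSum p (volume.restrict (unitBall d)) f ≤
      ∑ _k : Unit ⊕ Fin d ⊕ Fin d × Fin d, (K.toReal * (1 + (m + 1 + M))) ^ p := by
    rintro f ⟨u, G, H, hu, hj, hle, rfl⟩
    refine Finset.sum_le_sum fun k _ => ?_
    rw [toReal_eLpNorm_rpow hp (hj.memLp_jetFamily k)]
    refine Real.rpow_le_rpow ENNReal.toReal_nonneg ?_ (by linarith)
    have hXt : eLpNorm (fun x => F (H x)) (ENNReal.ofReal p)
      (volume.restrict (unitBall d)) ≠ ⊤ := (hF.memLp_comp hj).2.ne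
    have h1 := ENNReal.toReal_mono (by finiteness) (hK u G H hu hj k)
    rw [ENNReal.toReal_mul, ENNReal.toReal_add (by simp) hXt, ENNReal.toReal_one] at h1
    refine h1.trans (mul_le_mul_of_nonneg_left ?_ ENNReal.toReal_nonneg)
    have h2 := hM u G H hu hj
    simp only [CharP.cast_eq_zero, zero_add, div_one] at hle
    linarith
  obtain ⟨f, f', hfS, hf', ht⟩ := exists_selection_tendsto hp hanti hne hmid hLp hR
  choose u G H hu hj hle hfeq using hfS
  simp only [hfeq] at ht
  obtain ⟨u', G', H', hu', hj', htu, htH⟩ := exists_admissible_limit hp hg hu hj hf' ht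
  refine ⟨u', hu', fun w hw => ?_⟩
  have hE1 := tendsto_energy (γp := γp) (γm := γm) hp hF hj hj' (fun n => (hu n).2.2) hu'.2.2 htu
    htH
  have hE2 : Tendsto (fun n : ℕ => m + 1 / ((n : ℝ) + 1)) atTop (𝓝 m) := by
    simpa using (tendsto_one_div_add_atTop_nhds_zero_nat (𝕜 := ℝ)).const_add m
  exact (le_of_tendsto_of_tendsto' hE1 hE2 hle).trans (csInf_le hEbdd (mem_image_of_mem _ hw))

end Minimizer

end HessianEnergy

theorem mainTheorem6 (d : ℕ) (hd : 1 ≤ d) (p : ℝ) (hp : 1 < p)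
    (γp γm : ℝ) (hγp : 0 ≤ γp) (hγ : 0 < γp + γm)
    (lam Lam : ℝ) (F : SymMat d → ℝ) (hF : UniformlyElliptic lam Lam F)
    (hFconv : ConvexOn ℝ Set.univ F)
    (g : Space d → ℝ) (hg : MemW2 p (unitBall d) g)
    (hgconv : ConvexOn ℝ (unitBall d) g) :
    (∀ u ∈ admissible p g,
      (∀ᵐ x ∂(volume.restrict (unitBall d)), 0 ≤ F (weakHessian (unitBall d) u x)) ∧
        IntegrableOn (energyDensity F p γp γm u) (unitBall d)) ∧
    ∃ uStar ∈ admissible p g, ∀ u ∈ admissible p g,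
      energy F p γp γm uStar ≤ energy F p γp γm u := by
  refine ⟨fun u hu => ?_, exists_minimizer hd hp hγ.le hF hFconv hg hgconv⟩
  obtain ⟨G, H, h⟩ := memW2_iff_exists_jet.1 hu.1
  refine ⟨?_, h.integrable_energyDensity hp hF hu.2.2⟩
  filter_upwards [h.weakHessian_ae_eq, h.ae_nonneg hp hF hu.2.2] with x hx hx0
  rwa [hx]
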